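/- Let $n\ge 2$ be an integer, let $B$ be the open unit ball of $\mathbb R^n$, let $h\colon\mathbb R\to\mathbb R$ be continuous and one-to-one, let $\frac{n}{n-1}\le p\le\infty$ with H\"older conjugate exponent $p'=\frac{p}{p-1}$ ($p'=1$ if $p=\infty$), and let $\phi\in W^{1,p}_{loc}(0,1)$. Suppose that $u(x)=\phi(|x|)x$ is a weak solution of $$\operatorname{div}\big(h(\det Du)\operatorname{cof}Du\big)=0\quad\text{in } B,$$ that is, $u\in W^{1,1}_{loc}(B;\mathbb R^n)$ with weak Jacobian matrix $Du$, $h(\det Du)\operatorname{cof}Du\in L^1_{loc}(B;\mathbb R^{n\times n})$, and $$\int_B h(\det Du)\operatorname{cof}Du:D\zeta\,dx=0\qquad\text{for all }\zeta\in C_c^1(B;\mathbb R^n),$$ where $A:C=\sum_{i,j}A_{ij}C_{ij}$ and $\operatorname{cof}A$ is the cofactor matrix, $A^T\operatorname{cof}A=(\det A)I$. Suppose moreover that $h(\det Du)\operatorname{cof}Du\in L^{p'}_{loc}(B;\mathbb R^{n\times n})$. Then $\phi$, identified with its continuous representative on $(0,1)$, satisfies one of the following: either $\phi\equiv 0$ on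 $(0,1)$, or there are real constants $\lambda,c$ such that $$\phi(r)=\Big(\lambda+\frac{c}{r^n}\Big)^{1/n}\ne 0\qquad\text{for all } 0<r<1.$$ Here, if $n$ is odd, $(\cdot)^{1/n}$ is the real $n$-th root; if $n$ is even, $\lambda+c/r^n>0$ for all $r\in(0,1)$, and $(\cdot)^{1/n}$ denotes one of the two branches $\pm\sqrt[n]{\cdot}$, the same for all $r\in(0,1)$. -/

import Mathlib

open MeasureTheory Set
open scoped ENNReal ContDiff

/-- `f ∈ L^p_loc(Ω)` for a real-valued `f`: `f ∈ L^p(K)` for every compact `K ⊆ Ω`. -/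
def MemLpLoc {E : Type*} [TopologicalSpace E] [MeasureSpace E]
    (f : E → ℝ) (p : ℝ≥0∞) (Ω : Set E) : Prop :=
  ∀ K : Set E, IsCompact K → K ⊆ Ω → MemLp f p (volume.restrict K)

/-- `g` satisfies the defining identity of the weak derivative of `f` in the direction `v` on `Ω`:
`∫_Ω f ∂_v η = - ∫_Ω g η` for all `η ∈ C_c^∞(Ω)`. It is used only together with local
integrability of `f` and `g` on `Ω`. -/
def HasWeakDerivAlong {E : Type*} [NormedAddCommGroup E] [NormedSpace ℝ E] [MeasureSpace E]
    (Ω : Set E) (v : E) (f g : E → ℝ) : Prop :=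
  ∀ η : E → ℝ, ContDiff ℝ ∞ η → HasCompactSupport η → tsupport η ⊆ Ω →
    ∫ x in Ω, f x * fderiv ℝ η x v = - ∫ x in Ω, g x * η x

/-- `φ ∈ W^{1,p}_loc(I)` for a function of one real variable on the open set `I`. -/
def MemW1pLoc (φ : ℝ → ℝ) (p : ℝ≥0∞) (I : Set ℝ) : Prop :=
  MemLpLoc φ p I ∧ ∃ φ' : ℝ → ℝ, MemLpLoc φ' p I ∧ HasWeakDerivAlong I 1 φ φ'

/-- `u ∈ W^{1,1}_loc(Ω; ℝⁿ)` with weak Jacobian matrix `Du`, `(Du)ᵢⱼ = ∂uᵢ/∂xⱼ`. -/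
def HasWeakJacobian {n : ℕ} (Ω : Set (EuclideanSpace ℝ (Fin n)))
    (u : EuclideanSpace ℝ (Fin n) → EuclideanSpace ℝ (Fin n))
    (Du : EuclideanSpace ℝ (Fin n) → Matrix (Fin n) (Fin n) ℝ) : Prop :=
  (∀ i, MemLpLoc (fun x => u x i) 1 Ω) ∧
  ∀ i j, MemLpLoc (fun x => Du x i j) 1 Ω ∧
    HasWeakDerivAlong Ω (EuclideanSpace.single j 1) (fun x => u x i) (fun x => Du x i j)

/-- The cofactor matrix, so that `Aᵀ * cof A = det A • 1`. -/
def Matrix.cof {n : ℕ} (A : Matrix (Fin n) (Fin n) ℝ) : Matrix (Fin n) (Fin n) ℝ :=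
  A.adjugate.transpose

theorem Matrix.transpose_mul_cof {n : ℕ} (A : Matrix (Fin n) (Fin n) ℝ) :
    A.transpose * A.cof = A.det • (1 : Matrix (Fin n) (Fin n) ℝ) := by
  rw [Matrix.cof, ← Matrix.transpose_mul, Matrix.adjugate_mul, Matrix.transpose_smul,
    Matrix.transpose_one]

/-- The classical Jacobian matrix of `ζ`. -/
noncomputable def jacobian {n : ℕ}
    (ζ : EuclideanSpace ℝ (Fin n) → EuclideanSpace ℝ (Fin n)) (x : EuclideanSpace ℝ (Fin n)) :
    Matrix (Fin n) (Fin n) ℝ :=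
  Matrix.of fun i j => (fderiv ℝ ζ x (EuclideanSpace.single j 1)) i

/-- The inner product `A : B = ∑ Aᵢⱼ Bᵢⱼ` of matrices. -/
def Matrix.frob {n : ℕ} (A B : Matrix (Fin n) (Fin n) ℝ) : ℝ := ∑ i, ∑ j, A i j * B i j

/-- The field `h(det Du) cof Du`. -/
noncomputable def stress {n : ℕ} (h : ℝ → ℝ)
    (Du : EuclideanSpace ℝ (Fin n) → Matrix (Fin n) (Fin n) ℝ) (x : EuclideanSpace ℝ (Fin n)) :
    Matrix (Fin n) (Fin n) ℝ :=
  h (Du x).det • (Du x).cof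

/-- `σ ∈ L^q_loc(Ω; 𝕄^{n×n})`, entrywise. -/
def MatrixMemLpLoc {n : ℕ}
    (σ : EuclideanSpace ℝ (Fin n) → Matrix (Fin n) (Fin n) ℝ) (q : ℝ≥0∞)
    (Ω : Set (EuclideanSpace ℝ (Fin n))) : Prop :=
  ∀ i j, MemLpLoc (fun x => σ x i j) q Ω

/-- `u ∈ W^{1,1}_loc(Ω; ℝⁿ)`, with weak Jacobian `Du`, is a weak solution of
`div (h(det Du) cof Du) = 0` in `Ω`. -/
def IsWeakSolution {n : ℕ} (h : ℝ → ℝ) (Ω : Set (EuclideanSpace ℝ (Fin n)))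
    (u : EuclideanSpace ℝ (Fin n) → EuclideanSpace ℝ (Fin n))
    (Du : EuclideanSpace ℝ (Fin n) → Matrix (Fin n) (Fin n) ℝ) : Prop :=
  HasWeakJacobian Ω u Du ∧
  MatrixMemLpLoc (stress h Du) 1 Ω ∧
  ∀ ζ : EuclideanSpace ℝ (Fin n) → EuclideanSpace ℝ (Fin n),
    ContDiff ℝ 1 ζ → HasCompactSupport ζ → tsupport ζ ⊆ Ω →
      ∫ x in Ω, (stress h Du x).frob (jacobian ζ x) = 0

/-- The real `n`-th root of a real number `t` for odd `n`. -/
noncomputable def oddRoot (n : ℕ) (t : ℝ) : ℝ := (SignType.sign t : ℝ) * |t| ^ (1 / (n : ℝ))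

theorem oddRoot_pow {n : ℕ} (hn : Odd n) (t : ℝ) : oddRoot n t ^ n = t := by
  have h0 : n ≠ 0 := by rintro rfl; simp at hn
  rw [oddRoot, mul_pow, one_div, Real.rpow_inv_natCast_pow (abs_nonneg t) h0]
  rcases lt_trichotomy t 0 with h | h | h
  · simp [h, hn.neg_one_pow, abs_of_neg h]
  · simp [h]
  · simp [h, abs_of_pos h]

/-! Let `Φ` be the absolutely continuous representative of `φ`, with derivative `w`, and write r =
|x|. Off the origin Du = Φ I + (w/r) x xᵀ, so det Du = Φ^(n-1) (Φ + r w) and the cofactor is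
explicit. Testing the equation with ζ = η(|x|) x, whose Jacobian has the same form, and passing to
polar coordinates gives, with P = r^n Φ^(n-1) and H = h(det Du), the identity ∫ (H P η' + H P' η) dr
= 0. Hence H P has an absolutely continuous representative F with F' = H P'
(`IsWeakSolution.exists_isPrimitiveOn`).

On an interval where Φ ≠ 0 the quotient H = F/P is absolutely continuous with derivative (F' P - F
P')/P² = 0 almost everywhere, so H is constant, and injectivity of h makes det Du a constant l.
Since (r^n Φ^n)' = n r^(n-1) det Du, it follows that r^n Φ^n = l r^n + c there
(`exists_pow_eq_of_ne_zero`).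

A zero cannot coexist with a nonzero value. If z is the zero nearest to a point where Φ ≠ 0, then
r^n Φ^n = l (r^n - z^n) with l ≠ 0 between the two, and |Φ + r w|^(n/(n-1)) = |l|^(n/(n-1)) / |Φ|^n
is at least a multiple of 1/|r - z|, which is not integrable. This contradicts w ∈ L^(n/(n-1))_loc,
which p ≥ n/(n-1) guarantees (`false_of_zero_at_endpoint`). -/

/-! ### Primitives and absolutely continuous functions on an interval -/

/-- `F` is a primitive of `g` on `I`: `g` is integrable between any two points of `I` and
`F b - F a = ∫ g` over `[a, b]`. -/
def IsPrimitiveOn (F g : ℝ → ℝ) (I : Set ℝ) : Prop :=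
  ∀ a ∈ I, ∀ b ∈ I, IntervalIntegrable g volume a b ∧ F b - F a = ∫ x in a..b, g x

theorem AbsolutelyContinuousOnInterval.congr_of_eqOn {f g : ℝ → ℝ} {a b : ℝ}
    (hf : AbsolutelyContinuousOnInterval f a b) (h : EqOn f g (uIcc a b)) :
    AbsolutelyContinuousOnInterval g a b := by
  unfold AbsolutelyContinuousOnInterval at hf ⊢
  refine hf.congr' ?_
  have hmem : ∀ᶠ E in AbsolutelyContinuousOnInterval.totalLengthFilter ⊓
      Filter.principal (AbsolutelyContinuousOnInterval.disjWithin a b),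
      E ∈ AbsolutelyContinuousOnInterval.disjWithin a b :=
    Filter.eventually_inf_principal.mpr (by simp)
  filter_upwards [hmem] with E hE
  refine Finset.sum_congr rfl fun i hi => ?_
  rw [h (hE.1 i hi).1, h (hE.1 i hi).2]

namespace IsPrimitiveOn

variable {F g : ℝ → ℝ} {I : Set ℝ}

theorem absolutelyContinuousOnInterval [I.OrdConnected] (hF : IsPrimitiveOn F g I) {a b : ℝ}
    (ha : a ∈ I) (hb : b ∈ I) : AbsolutelyContinuousOnInterval F a b := by
  have h1 := ((hF a ha b hb).1.absolutelyContinuousOnInterval_intervalIntegral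
    (c := a) left_mem_uIcc)
  have h2 : AbsolutelyContinuousOnInterval (fun _ : ℝ => F a) a b :=
    (LipschitzWith.const (F a)).lipschitzOnWith.absolutelyContinuousOnInterval
  refine (h1.add h2).congr_of_eqOn fun x hx => ?_
  have := (hF a ha x (‹I.OrdConnected›.uIcc_subset ha hb hx)).2
  simp only [Pi.add_apply]
  linarith

theorem continuousOn_Ioo {α β : ℝ} (hF : IsPrimitiveOn F g (Ioo α β)) :
    ContinuousOn F (Ioo α β) := by
  intro x hx
  obtain ⟨a, ha⟩ := exists_between hx.1
  obtain ⟨b, hb⟩ := exists_between hx.2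
  have hc := (hF.absolutelyContinuousOnInterval (a := a) (b := b) ⟨ha.1, ha.2.trans hx.2⟩
    ⟨hx.1.trans hb.1, hb.2⟩).continuousOn
  rw [uIcc_of_le (ha.2.trans hb.1).le] at hc
  exact (hc.continuousAt (Icc_mem_nhds ha.2 hb.1)).continuousWithinAt

end IsPrimitiveOn

/-- Intervals with rational endpoints exhaust the open interval, so only countably many null sets
are discarded. -/
theorem ae_Ioo_of_forall_Icc {p : ℝ → Prop} {α β : ℝ}
    (H : ∀ a ∈ Ioo α β, ∀ b ∈ Ioo α β, ∀ᵐ x, x ∈ Icc a b → p x) :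
    ∀ᵐ x, x ∈ Ioo α β → p x := by
  have : ∀ᵐ x, ∀ q : ℚ × ℚ, (q.1 : ℝ) ∈ Ioo α β → (q.2 : ℝ) ∈ Ioo α β →
      x ∈ Icc (q.1 : ℝ) q.2 → p x := by
    rw [ae_all_iff]
    intro q
    by_cases h1 : (q.1 : ℝ) ∈ Ioo α β
    · by_cases h2 : (q.2 : ℝ) ∈ Ioo α β
      · filter_upwards [H _ h1 _ h2] with x hx _ _ using hx
      · simp [h2]
    · simp [h1]
  filter_upwards [this] with x hx hxI
  obtain ⟨a, ha⟩ := exists_rat_btwn hxI.1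
  obtain ⟨b, hb⟩ := exists_rat_btwn hxI.2
  exact hx (a, b) ⟨ha.1, ha.2.trans hxI.2⟩ ⟨hxI.1.trans hb.1, hb.2⟩ ⟨ha.2.le, hb.1.le⟩

theorem IsPrimitiveOn.ae_hasDerivAt {F g : ℝ → ℝ} {α β : ℝ} (hF : IsPrimitiveOn F g (Ioo α β)) :
    ∀ᵐ x, x ∈ Ioo α β → HasDerivAt F (g x) x := by
  have key : ∀ a ∈ Ioo α β, ∀ b ∈ Ioo α β, ∀ᵐ x, x ∈ Icc a b → HasDerivAt F (g x) x := by
    intro a ha b hb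
    rcases lt_or_ge b a with hab | hab
    · simp [Icc_eq_empty_of_lt hab]
    · filter_upwards [(hF a ha b hb).1.ae_hasDerivAt_integral, Measure.ae_ne volume a,
        Measure.ae_ne volume b] with x hx hxa hxb hxI
      have hd := (hx (by rwa [uIcc_of_le hab]) a left_mem_uIcc).add_const (F a)
      refine hd.congr_of_eventuallyEq ?_
      filter_upwards [Ioo_mem_nhds (lt_of_le_of_ne hxI.1 (Ne.symm hxa))
        (lt_of_le_of_ne hxI.2 hxb)] with y hy
      have := (hF a ha y ⟨ha.1.trans hy.1, hy.2.trans hb.2⟩).2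
      linarith
  exact ae_Ioo_of_forall_Icc key

theorem AbsolutelyContinuousOnInterval.comp_lipschitzOnWith {f φ : ℝ → ℝ} {a b : ℝ} {K : NNReal}
    {s : Set ℝ} (hf : AbsolutelyContinuousOnInterval f a b) (hφ : LipschitzOnWith K φ s)
    (hs : MapsTo f (uIcc a b) s) : AbsolutelyContinuousOnInterval (fun x => φ (f x)) a b := by
  unfold AbsolutelyContinuousOnInterval at hf ⊢
  have h0 := hf.const_mul (K : ℝ)
  rw [mul_zero] at h0
  refine squeeze_zero' (Filter.Eventually.of_forall fun E => Finset.sum_nonneg fun _ _ =>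
    dist_nonneg) ?_ h0
  have hmem : ∀ᶠ E in AbsolutelyContinuousOnInterval.totalLengthFilter ⊓
      Filter.principal (AbsolutelyContinuousOnInterval.disjWithin a b),
      E ∈ AbsolutelyContinuousOnInterval.disjWithin a b :=
    Filter.eventually_inf_principal.mpr (by simp)
  filter_upwards [hmem] with E hE
  rw [Finset.mul_sum]
  refine Finset.sum_le_sum fun i hi => ?_
  exact hφ.dist_le_mul _ (hs (hE.1 i hi).1) _ (hs (hE.1 i hi).2)

/-- By compactness |f| has a positive minimum m, and inversion is Lipschitz with constant m⁻² on
{|y| ≥ m}. -/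
theorem AbsolutelyContinuousOnInterval.fun_inv {f : ℝ → ℝ} {a b : ℝ}
    (hf : AbsolutelyContinuousOnInterval f a b) (h0 : ∀ x ∈ uIcc a b, f x ≠ 0) :
    AbsolutelyContinuousOnInterval (fun x => (f x)⁻¹) a b := by
  obtain ⟨x₀, hx₀, hmin⟩ := isCompact_uIcc.exists_isMinOn (nonempty_uIcc (a := a) (b := b))
    hf.continuousOn.abs
  set m := |f x₀|
  have hm : 0 < m := abs_pos.mpr (h0 _ hx₀)
  have hlip : LipschitzOnWith (Real.toNNReal ((m ^ 2)⁻¹)) (fun y : ℝ => y⁻¹) {y | m ≤ |y|} := by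
    refine LipschitzOnWith.of_dist_le_mul fun x hx y hy => ?_
    have hx' : m ≤ |x| := hx
    have hy' : m ≤ |y| := hy
    have hx0 : x ≠ 0 := abs_pos.mp (hm.trans_le hx')
    have hy0 : y ≠ 0 := abs_pos.mp (hm.trans_le hy')
    rw [Real.coe_toNNReal _ (by positivity), Real.dist_eq, Real.dist_eq, inv_sub_inv hx0 hy0,
      abs_div, abs_sub_comm y x, abs_mul, div_eq_inv_mul]
    gcongr
    nlinarith
  exact hf.comp_lipschitzOnWith hlip fun x hx => hmin hx

theorem AbsolutelyContinuousOnInterval.fun_pow {f : ℝ → ℝ} {a b : ℝ}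
    (hf : AbsolutelyContinuousOnInterval f a b) (k : ℕ) :
    AbsolutelyContinuousOnInterval (fun x => f x ^ k) a b := by
  induction k with
  | zero =>
    simpa using (LipschitzWith.const (1 : ℝ)).lipschitzOnWith.absolutelyContinuousOnInterval
  | succ k ih => simpa only [pow_succ] using ih.fun_mul hf

theorem absolutelyContinuousOnInterval_id (a b : ℝ) :
    AbsolutelyContinuousOnInterval (fun x : ℝ => x) a b :=
  LipschitzWith.id.lipschitzOnWith.absolutelyContinuousOnInterval

theorem exists_const_on_Ioo_of_ae_hasDerivAt_zero {f : ℝ → ℝ} {α β : ℝ}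
    (hf : ∀ a ∈ Ioo α β, ∀ b ∈ Ioo α β, AbsolutelyContinuousOnInterval f a b)
    (hd : ∀ᵐ x, x ∈ Ioo α β → HasDerivAt f 0 x) : ∃ C, ∀ x ∈ Ioo α β, f x = C := by
  rcases (Ioo α β).eq_empty_or_nonempty with h | ⟨m, hm⟩
  · exact ⟨0, by simp [h]⟩
  · refine ⟨f m, fun x hx => ?_⟩
    obtain ⟨C, hC⟩ := (hf m hm x hx).const_of_ae_hasDerivAt_zero (by
      filter_upwards [hd] with y hy hyI using hy (ordConnected_Ioo.uIcc_subset hm hx hyI))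
    rw [hC x right_mem_uIcc, hC m left_mem_uIcc]

/-! ### Weak derivatives in one variable -/

theorem exists_Ioo_of_isCompact_subset_Ioo {K : Set ℝ} (hK : IsCompact K) {α β : ℝ} (hαβ : α < β)
    (hs : K ⊆ Ioo α β) : ∃ a b, α < a ∧ a < b ∧ b < β ∧ K ⊆ Ioo a b := by
  rcases K.eq_empty_or_nonempty with rfl | hne
  · obtain ⟨a, ha⟩ := exists_between hαβ
    obtain ⟨b, hb⟩ := exists_between ha.2
    exact ⟨a, b, ha.1, hb.1, hb.2, by simp⟩
  · obtain ⟨x, hx⟩ := hK.exists_isLeast hne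
    obtain ⟨y, hy⟩ := hK.exists_isGreatest hne
    obtain ⟨a, ha⟩ := exists_between (hs hx.1).1
    obtain ⟨b, hb⟩ := exists_between (hs hy.1).2
    exact ⟨a, b, ha.1, ha.2.trans_le ((hx.2 hy.1).trans hb.1.le), hb.2,
      fun z hz => ⟨ha.2.trans_le (hx.2 hz), (hy.2 hz).trans_lt hb.1⟩⟩

/-- The primitive started to the left of the support vanishes again to its right because the mean is
zero. -/
theorem exists_contDiff_primitive {ψ : ℝ → ℝ} (hψ : ContDiff ℝ ∞ ψ) (hc : HasCompactSupport ψ)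
    {α β : ℝ} (hαβ : α < β) (hs : tsupport ψ ⊆ Ioo α β) (h0 : ∫ x, ψ x = 0) :
    ∃ η : ℝ → ℝ, ContDiff ℝ ∞ η ∧ HasCompactSupport η ∧ tsupport η ⊆ Ioo α β ∧
      ∀ x, deriv η x = ψ x := by
  obtain ⟨a, b, h1, h2, h3, h4⟩ := exists_Ioo_of_isCompact_subset_Ioo hc hαβ hs
  have hzero : ∀ x, x ∉ Ioo a b → ψ x = 0 := fun x hx =>
    image_eq_zero_of_notMem_tsupport fun h => hx (h4 h)
  have hderiv : ∀ x, HasDerivAt (fun x => ∫ t in a..x, ψ t) (ψ x) x := fun x =>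
    (hψ.continuous.integral_hasStrictDerivAt a x).hasDerivAt
  have hint : ∫ t in a..b, ψ t = 0 := by
    rw [intervalIntegral.integral_of_le h2.le, setIntegral_eq_integral_of_forall_compl_eq_zero, h0]
    exact fun x hx => hzero x fun h => hx (Ioo_subset_Ioc_self h)
  have hout : ∀ x, x ∉ Icc a b → ∫ t in a..x, ψ t = 0 := by
    intro x hx
    rcases lt_or_ge x a with hxa | hxa
    · refine (intervalIntegral.integral_congr (g := fun _ => 0) fun t ht => hzero t fun h => ?_).trans
        (by simp)
      rw [uIcc_of_ge hxa.le] at ht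
      exact absurd h.1 (not_lt.mpr ht.2)
    · have hxb : b < x := by
        by_contra! h
        exact hx ⟨hxa, h⟩
      rw [← intervalIntegral.integral_add_adjacent_intervals
        (hψ.continuous.intervalIntegrable a b) (hψ.continuous.intervalIntegrable b x), hint,
        zero_add]
      refine (intervalIntegral.integral_congr (g := fun _ => 0) fun t ht => hzero t fun h => ?_).trans
        (by simp)
      rw [uIcc_of_le hxb.le] at ht
      exact absurd h.2 (not_lt.mpr ht.1)
  have hsub : tsupport (fun x => ∫ t in a..x, ψ t) ⊆ Icc a b := by
    refine closure_minimal (fun x hx => ?_) isClosed_Icc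
    by_contra h
    exact hx (hout x h)
  refine ⟨fun x => ∫ t in a..x, ψ t, ?_, ?_, ?_, fun x => (hderiv x).deriv⟩
  · rw [contDiff_infty_iff_deriv]
    refine ⟨fun x => (hderiv x).differentiableAt, ?_⟩
    rwa [show deriv (fun x => ∫ t in a..x, ψ t) = ψ from funext fun x => (hderiv x).deriv]
  · exact isCompact_Icc.of_isClosed_subset (isClosed_tsupport _) hsub
  · exact hsub.trans (Icc_subset_Ioo h1 h3)

theorem LocallyIntegrableOn.integrable_mul_of_tsupport_subset {E : Type*} [NormedAddCommGroup E]
    [MeasurableSpace E] [OpensMeasurableSpace E] {μ : Measure E} {f η : E → ℝ} {U : Set E}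
    (hf : LocallyIntegrableOn f U μ) (hη : Continuous η)
    (hc : HasCompactSupport η) (hs : tsupport η ⊆ U) : Integrable (fun x => f x * η x) μ := by
  rw [← integrableOn_iff_integrable_of_support_subset (s := tsupport η)]
  · exact (hf.integrableOn_compact_subset hs hc).mul_continuousOn hη.continuousOn hc
  · exact fun x hx => subset_tsupport _ (right_ne_zero_of_mul hx)

theorem setIntegral_mul_eq_integral_of_tsupport_subset {E : Type*} [TopologicalSpace E]
    [MeasurableSpace E] {μ : Measure E} {f η : E → ℝ} {U : Set E} (hs : tsupport η ⊆ U) :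
    ∫ x in U, f x * η x ∂μ = ∫ x, f x * η x ∂μ :=
  setIntegral_eq_integral_of_forall_compl_eq_zero fun x hx => by
    rw [image_eq_zero_of_notMem_tsupport fun h => hx (hs h), mul_zero]

/-- The du Bois-Reymond argument: subtracting (∫ψ) τ from a test function ψ, where τ is a bump of
integral one, leaves mean zero, hence the derivative of a test function. This forces f to equal the
constant ∫ f τ. -/
theorem exists_ae_eq_const_of_weakDeriv_zero {f : ℝ → ℝ} {α β : ℝ} (hαβ : α < β)
    (hf : LocallyIntegrableOn f (Ioo α β))
    (H : ∀ η : ℝ → ℝ, ContDiff ℝ ∞ η → HasCompactSupport η → tsupport η ⊆ Ioo α β →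
      ∫ x, f x * deriv η x = 0) :
    ∃ c, ∀ᵐ x, x ∈ Ioo α β → f x = c := by
  let θ : ContDiffBump ((α + β) / 2) := ⟨(β - α) / 8, (β - α) / 4, by linarith, by linarith⟩
  let τ : ℝ → ℝ := θ.normed volume
  have hτs : tsupport τ ⊆ Ioo α β := by
    rw [θ.tsupport_normed_eq, Real.closedBall_eq_Icc]
    refine Icc_subset_Ioo ?_ ?_ <;> simp only [θ] <;> linarith
  have hτc : HasCompactSupport τ := θ.hasCompactSupport_normed
  have hτd : ContDiff ℝ ∞ τ := θ.contDiff_normed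
  refine ⟨∫ x, f x * τ x, ?_⟩
  have hcst : LocallyIntegrableOn (fun x => f x - ∫ x, f x * τ x) (Ioo α β) :=
    hf.sub ((locallyIntegrable_const _).locallyIntegrableOn _)
  have := isOpen_Ioo.ae_eq_zero_of_integral_contDiff_smul_eq_zero hcst ?_
  · filter_upwards [this] with x hx hxI
    exact sub_eq_zero.mp (hx hxI)
  intro ψ hψ hψc hψs
  have hsub : ∀ x ∉ Ioo α β, ψ x - (∫ y, ψ y) * τ x = 0 := fun x hx => by
    rw [image_eq_zero_of_notMem_tsupport fun h => hx (hψs h),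
      image_eq_zero_of_notMem_tsupport fun h => hx (hτs h)]
    simp
  have htsub : tsupport (fun x => ψ x - (∫ y, ψ y) * τ x) ⊆ tsupport ψ ∪ tsupport τ := by
    refine closure_minimal (fun x hx => ?_) ((isClosed_tsupport _).union (isClosed_tsupport _))
    by_contra h
    rw [mem_union, not_or] at h
    refine hx ?_
    simp [image_eq_zero_of_notMem_tsupport h.1, image_eq_zero_of_notMem_tsupport h.2]
  have hψi : Integrable ψ := hψ.continuous.integrable_of_hasCompactSupport hψc
  have hτi : Integrable τ := hτd.continuous.integrable_of_hasCompactSupport hτc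
  obtain ⟨η, h1, h2, h3, h4⟩ := exists_contDiff_primitive
    (ψ := fun x => ψ x - (∫ y, ψ y) * τ x) (hψ.sub (contDiff_const.mul hτd))
    ((hψc.union hτc).of_isClosed_subset (isClosed_tsupport _) htsub) hαβ
    (htsub.trans (union_subset hψs hτs)) (by
      rw [integral_sub hψi (hτi.const_mul _), integral_const_mul, θ.integral_normed]
      ring)
  have h5 := H η h1 h2 h3
  simp only [h4] at h5
  have i1 := LocallyIntegrableOn.integrable_mul_of_tsupport_subset hf hψ.continuous hψc hψs
  have i2 := LocallyIntegrableOn.integrable_mul_of_tsupport_subset hf hτd.continuous hτc hτs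
  have e1 : ∫ x, f x * (ψ x - (∫ y, ψ y) * τ x) =
      (∫ x, f x * ψ x) - (∫ y, ψ y) * ∫ x, f x * τ x := by
    rw [← integral_const_mul, ← integral_sub i1 (i2.const_mul _)]
    exact integral_congr_ae (.of_forall fun x => by ring)
  have e2 : ∫ x, ψ x • (f x - ∫ x, f x * τ x) =
      (∫ x, f x * ψ x) - (∫ y, ψ y) * ∫ x, f x * τ x := by
    rw [mul_comm (∫ y, ψ y), ← integral_const_mul, ← integral_sub i1 (hψi.const_mul _)]
    exact integral_congr_ae (.of_forall fun x => by simp only [smul_eq_mul]; ring)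
  rw [e2, ← e1, h5]

theorem IsPrimitiveOn.integral_mul_deriv {F g : ℝ → ℝ} {α β : ℝ} (hαβ : α < β)
    (hF : IsPrimitiveOn F g (Ioo α β)) {η : ℝ → ℝ} (hη : ContDiff ℝ 1 η)
    (hc : HasCompactSupport η) (hs : tsupport η ⊆ Ioo α β) :
    ∫ x, F x * deriv η x = - ∫ x, g x * η x := by
  obtain ⟨a, b, h1, h2, h3, h4⟩ := exists_Ioo_of_isCompact_subset_Ioo hc hαβ hs
  have ha : a ∈ Ioo α β := ⟨h1, h2.trans h3⟩
  have hb : b ∈ Ioo α β := ⟨h1.trans h2, h3⟩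
  have hz : ∀ x ∉ Ioo a b, x ∉ tsupport η := fun x hx h => hx (h4 h)
  have hη0 : ∀ x ∉ Ioo a b, η x = 0 := fun x hx => image_eq_zero_of_notMem_tsupport (hz x hx)
  have hη' : ∀ x ∉ Ioo a b, deriv η x = 0 := fun x hx =>
    image_eq_zero_of_notMem_tsupport fun h => hz x hx (tsupport_deriv_subset h)
  have e : ∀ k : ℝ → ℝ, (∀ x ∉ Ioo a b, k x = 0) → ∫ x, k x = ∫ x in a..b, k x := fun k hk => by
    rw [intervalIntegral.integral_of_le h2.le, setIntegral_eq_integral_of_forall_compl_eq_zero]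
    exact fun x hx => hk x fun h => hx (Ioo_subset_Ioc_self h)
  rw [e _ fun x hx => by rw [hη' x hx, mul_zero], e _ fun x hx => by rw [hη0 x hx, mul_zero]]
  have hηac : AbsolutelyContinuousOnInterval η a b := hη.contDiffOn.absolutelyContinuousOnInterval
  rw [(hF.absolutelyContinuousOnInterval ha hb).integral_mul_deriv_eq_deriv_mul hηac,
    hη0 a (by simp), hη0 b (by simp)]
  simp only [mul_zero, sub_zero, zero_sub, neg_inj]
  refine intervalIntegral.integral_congr_ae ?_
  filter_upwards [hF.ae_hasDerivAt] with x hx hxI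
  rw [uIoc_of_le h2.le] at hxI
  rw [(hx ⟨h1.trans hxI.1, hxI.2.trans_lt h3⟩).deriv]

/-- The difference between f and an indefinite integral of g has weak derivative zero, so it is
almost everywhere constant. -/
theorem exists_isPrimitiveOn_of_weakDeriv {f g : ℝ → ℝ} {α β : ℝ} (hαβ : α < β)
    (hf : LocallyIntegrableOn f (Ioo α β)) (hg : LocallyIntegrableOn g (Ioo α β))
    (H : ∀ η : ℝ → ℝ, ContDiff ℝ ∞ η → HasCompactSupport η → tsupport η ⊆ Ioo α β →
      ∫ x, f x * deriv η x = - ∫ x, g x * η x) :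
    ∃ F, IsPrimitiveOn F g (Ioo α β) ∧ ∀ᵐ x, x ∈ Ioo α β → f x = F x := by
  obtain ⟨m, hm⟩ := exists_between hαβ
  have hi : ∀ a ∈ Ioo α β, ∀ b ∈ Ioo α β, IntervalIntegrable g volume a b := fun a ha b hb =>
    (hg.integrableOn_compact_subset (ordConnected_Ioo.uIcc_subset ha hb)
      isCompact_uIcc).intervalIntegrable
  have hG : IsPrimitiveOn (fun x => ∫ t in m..x, g t) g (Ioo α β) := fun a ha b hb =>
    ⟨hi a ha b hb, intervalIntegral.integral_interval_sub_left (hi m hm b hb) (hi m hm a ha)⟩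
  have hGl : LocallyIntegrableOn (fun x => ∫ t in m..x, g t) (Ioo α β) :=
    hG.continuousOn_Ioo.locallyIntegrableOn measurableSet_Ioo
  obtain ⟨c, hc⟩ := exists_ae_eq_const_of_weakDeriv_zero hαβ (hf.sub hGl) (by
    intro η h1 h2 h3
    have h1' : ContDiff ℝ 1 η := h1.of_le (by simp)
    have hd : Continuous (deriv η) := h1'.continuous_deriv le_rfl
    have hs := (tsupport_deriv_subset (f := η)).trans h3
    have i1 := LocallyIntegrableOn.integrable_mul_of_tsupport_subset hf hd h2.deriv hs
    have i2 := LocallyIntegrableOn.integrable_mul_of_tsupport_subset hGl hd h2.deriv hs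
    simp only [Pi.sub_apply, sub_mul]
    rw [integral_sub i1 i2, H η h1 h2 h3, hG.integral_mul_deriv hαβ h1' h2 h3, sub_self])
  refine ⟨fun x => c + ∫ t in m..x, g t, fun a ha b hb => ⟨hi a ha b hb, ?_⟩, ?_⟩
  · have := (hG a ha b hb).2
    simp only at this ⊢
    linarith
  · filter_upwards [hc] with x hx hxI
    have := hx hxI
    simp only [Pi.sub_apply] at this
    linarith

theorem MemLpLoc.locallyIntegrableOn {E : Type*} [NormedAddCommGroup E] [ProperSpace E]
    [MeasureSpace E] [BorelSpace E] [IsFiniteMeasureOnCompacts (volume : Measure E)]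
    {f : E → ℝ} {p : ℝ≥0∞} {Ω : Set E}
    (hΩ : IsOpen Ω) (hp : 1 ≤ p) (hf : MemLpLoc f p Ω) : LocallyIntegrableOn f Ω := by
  rw [locallyIntegrableOn_iff hΩ.isLocallyClosed]
  intro K hKs hK
  have : IsFiniteMeasure (volume.restrict K) := ⟨by simpa using hK.measure_lt_top⟩
  exact memLp_one_iff_integrable.mp ((hf K hK hKs).mono_exponent hp)

theorem IntegrableOn.integrable_mul_of_support_subset {E : Type*} [NormedAddCommGroup E]
    [MeasurableSpace E] [OpensMeasurableSpace E] {μ : Measure E} {f η : E → ℝ} {K : Set E}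
    (hf : IntegrableOn f K μ) (hη : ContinuousOn η K) (hK : IsCompact K)
    (hs : Function.support η ⊆ K) : Integrable (fun x => f x * η x) μ := by
  rw [← integrableOn_iff_integrable_of_support_subset (s := K)]
  · exact hf.mul_continuousOn hη hK
  · exact fun x hx => hs (right_ne_zero_of_mul hx)

/-! ### Radial functions: polar coordinates and weak gradients -/

section Radial

variable {E : Type*} [NormedAddCommGroup E]

theorem isCompact_norm_preimage_Icc [ProperSpace E] (a b : ℝ) : IsCompact {x : E | ‖x‖ ∈ Icc a b} :=
  (isCompact_closedBall (0 : E) b).of_isClosed_subset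
    (isClosed_Icc.preimage continuous_norm) fun x hx => by
      simpa using hx.2

theorem exists_annulus_of_isCompact {K : Set E} (hK : IsCompact K)
    (hs : K ⊆ Metric.ball 0 1 \ {0}) :
    ∃ a b : ℝ, 0 < a ∧ a < b ∧ b < 1 ∧ K ⊆ {x : E | ‖x‖ ∈ Icc a b} := by
  obtain ⟨a, b, h1, h2, h3, h4⟩ := exists_Ioo_of_isCompact_subset_Ioo
    (hK.image continuous_norm) (α := 0) (β := 1) one_pos (by
      rintro _ ⟨x, hx, rfl⟩
      have := hs hx
      exact ⟨norm_pos_iff.mpr this.2, by simpa using this.1⟩)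
  exact ⟨a, b, h1, h2, h3, fun x hx => Ioo_subset_Icc_self (h4 (mem_image_of_mem _ hx))⟩

variable [InnerProductSpace ℝ E]

theorem hasFDerivAt_norm_of_ne_zero {x : E} (hx : x ≠ 0) :
    HasFDerivAt (fun y : E => ‖y‖) (‖x‖⁻¹ • innerSL ℝ x) x := by
  have h0 : ‖x‖ ≠ 0 := norm_ne_zero_iff.mpr hx
  have h1 := (Real.hasDerivAt_sqrt (pow_ne_zero 2 h0)).comp_hasFDerivAt x
    (hasStrictFDerivAt_norm_sq x).hasFDerivAt
  have h2 : (Real.sqrt ∘ fun y : E => ‖y‖ ^ 2) = fun y : E => ‖y‖ :=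
    funext fun y => Real.sqrt_sq (norm_nonneg y)
  rw [h2, Real.sqrt_sq (norm_nonneg x)] at h1
  convert! h1 using 1
  ext v
  simp
  field_simp

variable [FiniteDimensional ℝ E] [MeasurableSpace E] [BorelSpace E] (μ : Measure E)
  [μ.IsAddHaarMeasure]

/-- Classical integration by parts: the norm is differentiable off the origin, and ξ is supported
away from it. -/
theorem integral_norm_comp_mul_fderiv_of_continuous {G g : ℝ → ℝ} (hg : Continuous g)
    (hG : ∀ r, HasDerivAt G (g r) r) {ξ : E → ℝ} (hξ : ContDiff ℝ 1 ξ)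
    (hc : HasCompactSupport ξ) (hs : tsupport ξ ⊆ Metric.ball 0 1 \ {0}) (v : E) :
    ∫ x, G ‖x‖ * fderiv ℝ ξ x v ∂μ = - ∫ x, g ‖x‖ * (inner ℝ x v / ‖x‖ * ξ x) ∂μ := by
  have hne : ∀ x ∈ tsupport ξ, x ≠ 0 := fun x hx => (hs hx).2
  have hd : ∀ x : E, x ≠ 0 → HasFDerivAt (fun y : E => G ‖y‖) (g ‖x‖ • ‖x‖⁻¹ • innerSL ℝ x) x :=
    fun x hx => (hG ‖x‖).comp_hasFDerivAt x (hasFDerivAt_norm_of_ne_zero hx)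
  have hGc : Continuous G := continuous_iff_continuousAt.mpr fun r => (hG r).continuousAt
  have e : ∀ x, fderiv ℝ (fun y : E => G ‖y‖) x v * ξ x = g ‖x‖ * (inner ℝ x v / ‖x‖ * ξ x) := by
    intro x
    by_cases hx : x ∈ tsupport ξ
    · rw [(hd x (hne x hx)).fderiv]
      simp
      ring
    · simp [image_eq_zero_of_notMem_tsupport hx]
  have hfs : Function.support (fun x => fderiv ℝ ξ x v) ⊆ tsupport ξ := fun x hx => by
    by_contra h
    exact hx (by simp [fderiv_of_notMem_tsupport (𝕜 := ℝ) h])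
  have hcn : Continuous fun x : E => G ‖x‖ := hGc.comp continuous_norm
  have := integral_mul_fderiv_eq_neg_fderiv_mul_of_integrable (μ := μ) (f := fun x : E => G ‖x‖)
    (g := ξ) (v := v) ?_ ?_ ?_ (fun x hx => (hd x (hne x hx)).differentiableAt)
    (fun x _ => hξ.differentiable one_ne_zero x)
  · simpa only [e] using this
  · simp only [e]
    refine IntegrableOn.integrable_mul_of_support_subset (K := tsupport ξ) ?_ ?_ hc ?_
    · exact (hg.comp continuous_norm).continuousOn.integrableOn_compact hc
    · exact ((by fun_prop : Continuous fun x : E => inner ℝ x v).continuousOn.div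
        continuous_norm.continuousOn fun x hx => norm_ne_zero_iff.mpr (hne x hx)).mul
        hξ.continuous.continuousOn
    · exact fun x hx => subset_tsupport _ (right_ne_zero_of_mul hx)
  · refine IntegrableOn.integrable_mul_of_support_subset (K := tsupport ξ)
      (hcn.continuousOn.integrableOn_compact hc) ?_ hc hfs
    exact (hξ.continuous_fderiv_apply one_ne_zero |>.comp
      (continuous_id.prodMk continuous_const)).continuousOn
  · exact IntegrableOn.integrable_mul_of_support_subset (K := tsupport ξ)
      (hcn.continuousOn.integrableOn_compact hc) hξ.continuous.continuousOn hc
      (subset_tsupport _)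

variable [Nontrivial E]

/-- In polar coordinates the indicator of a null set of radii has integral zero over the whole
space. -/
theorem ae_norm_of_ae_pos {p : ℝ → Prop} (h : ∀ᵐ r : ℝ, 0 < r → p r) :
    ∀ᵐ x ∂μ, x ≠ 0 → p ‖x‖ := by
  set N := toMeasurable volume {r : ℝ | ¬ (0 < r → p r)}
  have hN : volume N = 0 := by rw [measure_toMeasurable]; exact h
  let f : ℝ → ℝ := N.indicator 1
  have hf : (fun y : ℝ => y ^ (Module.finrank ℝ E - 1) • f y) =ᵐ[volume.restrict (Ioi 0)] 0 := by
    refine ae_restrict_of_ae ?_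
    filter_upwards [measure_eq_zero_iff_ae_notMem.mp hN] with r hr
    simp [f, hr]
  have hi : Integrable (fun x : E => f ‖x‖) μ := by
    rw [integrable_fun_norm_addHaar]
    exact (integrable_zero _ _ _).congr hf.symm
  have h0 : ∫ x, f ‖x‖ ∂μ = 0 := by
    rw [integral_fun_norm_addHaar, integral_congr_ae hf]
    simp
  rw [integral_eq_zero_iff_of_nonneg (fun x => indicator_nonneg (by simp) _) hi] at h0
  filter_upwards [h0] with x hx hx0
  by_contra hp
  have : ‖x‖ ∈ N := subset_toMeasurable _ _ (by simp [hx0, hp])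
  simp [this] at hx

/-- Serves in both directions: to lift one-variable integrability to an annulus, and to bring
integrability of the stress down to the radial variable. -/
theorem integrableOn_norm_comp_iff {F : ℝ → ℝ} {a b : ℝ} (ha : 0 < a) :
    IntegrableOn (fun x : E => F ‖x‖) {x : E | ‖x‖ ∈ Icc a b} μ ↔
      IntegrableOn (fun r => r ^ (Module.finrank ℝ E - 1) * F r) (Icc a b) := by
  have h1 : MeasurableSet {x : E | ‖x‖ ∈ Icc a b} :=
    (isCompact_norm_preimage_Icc a b).measurableSet
  rw [← integrable_indicator_iff h1]
  have h2 : ({x : E | ‖x‖ ∈ Icc a b}.indicator fun x : E => F ‖x‖) =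
      fun x : E => (Icc a b).indicator F ‖x‖ := by
    ext x
    simp [indicator]
  rw [h2, integrable_fun_norm_addHaar, ← integrable_indicator_iff measurableSet_Ioi,
    ← integrable_indicator_iff measurableSet_Icc]
  have h3 : ((Ioi (0 : ℝ)).indicator fun y => y ^ (Module.finrank ℝ E - 1) •
      (Icc a b).indicator F y) =
      (Icc a b).indicator fun r => r ^ (Module.finrank ℝ E - 1) * F r := by
    ext r
    by_cases hr : r ∈ Icc a b
    · have : 0 < r := ha.trans_le hr.1
      simp [hr, this]
    · simp [hr]
  rw [h3]

theorem integrableOn_norm_comp {F : ℝ → ℝ} {a b : ℝ} (ha : 0 < a)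
    (hF : IntegrableOn F (Icc a b)) :
    IntegrableOn (fun x : E => F ‖x‖) {x : E | ‖x‖ ∈ Icc a b} μ := by
  rw [integrableOn_norm_comp_iff μ ha]
  exact hF.continuousOn_mul (by fun_prop) isCompact_Icc

/-- The constant is the area of the unit sphere. The Jacobian weight r^(dim - 1) is dropped because
r ≤ b ≤ 1. -/
theorem integral_norm_comp_le {F : ℝ → ℝ} {a b : ℝ} (ha : 0 < a) (hb : b ≤ 1)
    (hF : IntegrableOn F (Icc a b)) :
    ∫ x in {x : E | ‖x‖ ∈ Icc a b}, |F ‖x‖| ∂μ ≤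
      Module.finrank ℝ E * μ.real (Metric.ball 0 1) * ∫ r in Icc a b, |F r| := by
  have h1 : MeasurableSet {x : E | ‖x‖ ∈ Icc a b} :=
    (isCompact_norm_preimage_Icc a b).measurableSet
  have h2 : ({x : E | ‖x‖ ∈ Icc a b}.indicator fun x : E => |F ‖x‖|) =
      fun x : E => (Icc a b).indicator (fun r => |F r|) ‖x‖ := by
    ext x
    simp [indicator]
  have h3 : ((Ioi (0 : ℝ)).indicator fun y => y ^ (Module.finrank ℝ E - 1) •
      (Icc a b).indicator (fun r => |F r|) y) =
      (Icc a b).indicator fun r => r ^ (Module.finrank ℝ E - 1) * |F r| := by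
    ext r
    by_cases hr : r ∈ Icc a b
    · have : 0 < r := ha.trans_le hr.1
      simp [hr, this]
    · simp [hr]
  rw [← integral_indicator h1, h2, integral_fun_norm_addHaar, ← integral_indicator
    measurableSet_Ioi, h3, integral_indicator measurableSet_Icc, nsmul_eq_mul, smul_eq_mul,
    ← mul_assoc]
  refine mul_le_mul_of_nonneg_left ?_ (by positivity)
  refine setIntegral_mono_on (IntegrableOn.continuousOn_mul
    (by fun_prop) hF.abs isCompact_Icc) hF.abs
    measurableSet_Icc fun r hr => ?_
  exact mul_le_of_le_one_left (abs_nonneg _) (pow_le_one₀ (ha.le.trans hr.1) (hr.2.trans hb))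

/-- The weak gradient of F(|x|) off the origin is w(|x|) x/|x|. It follows from the continuous case
by approximating w in L¹ of a compact interval of radii: the primitives are then uniformly close,
and both integrals change by a multiple of ε. -/
theorem IsPrimitiveOn.integral_norm_comp_mul_fderiv {F w : ℝ → ℝ}
    (hF : IsPrimitiveOn F w (Ioo 0 1)) {ξ : E → ℝ} (hξ : ContDiff ℝ 1 ξ)
    (hc : HasCompactSupport ξ) (hs : tsupport ξ ⊆ Metric.ball 0 1 \ {0}) (v : E) :
    ∫ x, F ‖x‖ * fderiv ℝ ξ x v ∂μ = - ∫ x, w ‖x‖ * (inner ℝ x v / ‖x‖ * ξ x) ∂μ := by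
  obtain ⟨a, b, ha, hab, hb, hsub⟩ := exists_annulus_of_isCompact hc hs
  have haI : a ∈ Ioo (0 : ℝ) 1 := ⟨ha, hab.trans hb⟩
  have hbI : b ∈ Ioo (0 : ℝ) 1 := ⟨ha.trans hab, hb⟩
  set A : Set E := {x : E | ‖x‖ ∈ Icc a b}
  have hAc : IsCompact A := isCompact_norm_preimage_Icc a b
  have hne : ∀ x ∈ A, x ≠ 0 := fun x hx => norm_pos_iff.mp (ha.trans_le hx.1)
  set D : E → ℝ := fun x => fderiv ℝ ξ x v
  set k : E → ℝ := fun x => inner ℝ x v / ‖x‖ * ξ x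
  have hDc : Continuous D := hξ.continuous_fderiv_apply one_ne_zero |>.comp
      (continuous_id.prodMk continuous_const)
  have hDs : Function.support D ⊆ A := fun x hx => by
    by_contra h
    exact hx (by simp [D, fderiv_of_notMem_tsupport (𝕜 := ℝ) fun h' => h (hsub h')])
  have hDi : Integrable D μ := by
    refine hDc.integrable_of_hasCompactSupport (hAc.of_isClosed_subset (isClosed_tsupport _) ?_)
    exact closure_minimal hDs hAc.isClosed
  have hks : Function.support k ⊆ A := fun x hx =>
    hsub (subset_tsupport _ (right_ne_zero_of_mul hx))
  have hkc : ContinuousOn k A :=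
    ((by fun_prop : Continuous fun x : E => inner ℝ x v).continuousOn.div
        continuous_norm.continuousOn fun x hx => norm_ne_zero_iff.mpr (hne x hx)).mul
        hξ.continuous.continuousOn
  obtain ⟨M, hM⟩ := hAc.exists_bound_of_continuousOn hkc
  have hM0 : 0 ≤ max M 0 := le_max_right _ _
  have hwi : IntegrableOn w (Icc a b) :=
    (intervalIntegrable_iff_integrableOn_Icc_of_le hab.le).mp (hF a haI b hbI).1
  have hFc : ContinuousOn (fun x : E => F ‖x‖) A :=
    (hF.continuousOn_Ioo.mono (Icc_subset_Ioo ha hb)).comp continuous_norm.continuousOn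
      fun x hx => hx
  set N : ℝ := Module.finrank ℝ E * μ.real (Metric.ball (0 : E) 1)
  have hN0 : 0 ≤ N := by positivity
  have bound : ∀ ε > 0, |(∫ x, F ‖x‖ * D x ∂μ) + ∫ x, w ‖x‖ * k x ∂μ| ≤
      ε * ((∫ x, |D x| ∂μ) + max M 0 * N) := by
    intro ε hε
    obtain ⟨g, -, hgε, hgc, hgi⟩ := (integrable_indicator_iff measurableSet_Icc |>.mpr
      hwi).exists_hasCompactSupport_integral_sub_le hε
    -- G starts at F a, so |F - G| on the interval is at most the L¹ distance of w and g.
    set G : ℝ → ℝ := fun r => F a + ∫ t in a..r, g t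
    have hGd : ∀ r, HasDerivAt G (g r) r := fun r =>
      ((hgc.integral_hasStrictDerivAt a r).hasDerivAt).const_add _
    have hGc : Continuous G := continuous_iff_continuousAt.mpr fun r => (hGd r).continuousAt
    have hgG := integral_norm_comp_mul_fderiv_of_continuous μ hgc hGd hξ hc hs v
    have hdi : IntegrableOn (fun r => w r - g r) (Icc a b) :=
      hwi.sub (hgc.continuousOn.integrableOn_compact isCompact_Icc)
    have hdε : ∫ r in Icc a b, |w r - g r| ≤ ε := by
      refine le_trans ?_ hgε
      have e1 : ∫ r in Icc a b, |w r - g r| =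
          ∫ r in Icc a b, ‖(Icc a b).indicator w r - g r‖ :=
        setIntegral_congr_fun measurableSet_Icc fun r hr => by
          simp only [indicator_of_mem hr, Real.norm_eq_abs]
      rw [e1]
      exact setIntegral_le_integral ((integrable_indicator_iff measurableSet_Icc |>.mpr
        hwi).sub hgi).norm (.of_forall fun r => norm_nonneg _)
    have hFG : ∀ r ∈ Icc a b, |F r - G r| ≤ ε := by
      intro r hr
      have hrI : r ∈ Ioo (0 : ℝ) 1 := ⟨ha.trans_le hr.1, hr.2.trans_lt hb⟩
      have e1 : F r - G r = ∫ t in a..r, (w t - g t) := by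
        rw [intervalIntegral.integral_sub (hF a haI r hrI).1 (hgc.intervalIntegrable _ _),
          ← (hF a haI r hrI).2]
        simp only [G]
        ring
      rw [e1, intervalIntegral.integral_of_le hr.1]
      refine (abs_integral_le_integral_abs).trans (le_trans ?_ hdε)
      exact setIntegral_mono_set hdi.abs (.of_forall fun _ => abs_nonneg _)
        (Filter.Eventually.of_forall fun t ht => ⟨ht.1.le, ht.2.trans hr.2⟩)
    have i1 : Integrable (fun x => F ‖x‖ * D x) μ :=
      IntegrableOn.integrable_mul_of_support_subset (hFc.integrableOn_compact hAc)
        hDc.continuousOn hAc hDs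
    have i2 : Integrable (fun x => w ‖x‖ * k x) μ :=
      IntegrableOn.integrable_mul_of_support_subset (integrableOn_norm_comp μ ha hwi) hkc hAc hks
    have i3 : Integrable (fun x => G ‖x‖ * D x) μ :=
      IntegrableOn.integrable_mul_of_support_subset
        ((hGc.comp continuous_norm).continuousOn.integrableOn_compact hAc)
        hDc.continuousOn hAc hDs
    have i4 : Integrable (fun x => g ‖x‖ * k x) μ :=
      IntegrableOn.integrable_mul_of_support_subset
        ((hgc.comp continuous_norm).continuousOn.integrableOn_compact hAc) hkc hAc hks
    have e2 : (∫ x, F ‖x‖ * D x ∂μ) + ∫ x, w ‖x‖ * k x ∂μ =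
        (∫ x, (F ‖x‖ * D x - G ‖x‖ * D x) ∂μ) + ∫ x, (w ‖x‖ * k x - g ‖x‖ * k x) ∂μ := by
      rw [integral_sub i1 i3, integral_sub i2 i4, hgG]
      ring
    have b1 : |∫ x, (F ‖x‖ * D x - G ‖x‖ * D x) ∂μ| ≤ ε * ∫ x, |D x| ∂μ := by
      rw [← integral_const_mul, ← Real.norm_eq_abs]
      refine norm_integral_le_of_norm_le (hDi.abs.const_mul ε) (.of_forall fun x => ?_)
      rw [← sub_mul, Real.norm_eq_abs, abs_mul]
      by_cases hx : x ∈ A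
      · exact mul_le_mul_of_nonneg_right (hFG _ hx) (abs_nonneg _)
      · simp [Function.notMem_support.mp fun h => hx (hDs h)]
    have b2 : |∫ x, (w ‖x‖ * k x - g ‖x‖ * k x) ∂μ| ≤ ε * (max M 0 * N) := by
      have hi : IntegrableOn (fun x : E => |w ‖x‖ - g ‖x‖|) A μ :=
        (integrableOn_norm_comp μ ha hdi).abs
      have h1 : |∫ x, (w ‖x‖ * k x - g ‖x‖ * k x) ∂μ| ≤
          ∫ x, max M 0 * A.indicator (fun x : E => |w ‖x‖ - g ‖x‖|) x ∂μ := by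
        rw [← Real.norm_eq_abs]
        refine norm_integral_le_of_norm_le
          (((integrable_indicator_iff hAc.measurableSet).mpr hi).const_mul _)
          (.of_forall fun x => ?_)
        rw [← sub_mul, Real.norm_eq_abs, abs_mul]
        by_cases hx : x ∈ A
        · rw [indicator_of_mem hx, mul_comm]
          exact mul_le_mul_of_nonneg_right ((hM x hx).trans (le_max_left _ _)) (abs_nonneg _)
        · simp [hx, Function.notMem_support.mp fun h => hx (hks h)]
      refine h1.trans ?_
      rw [integral_const_mul, integral_indicator hAc.measurableSet]
      have h2 := integral_norm_comp_le μ ha hb.le hdi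
      calc _ ≤ max M 0 * (N * ∫ r in Icc a b, |w r - g r|) :=
            mul_le_mul_of_nonneg_left h2 hM0
        _ ≤ max M 0 * (N * ε) := by gcongr
        _ = _ := by ring
    rw [e2]
    calc _ ≤ _ := abs_add_le _ _
      _ ≤ _ := add_le_add b1 b2
      _ = _ := by ring
  have hC : 0 ≤ (∫ x, |D x| ∂μ) + max M 0 * N :=
    add_nonneg (integral_nonneg fun _ => abs_nonneg _) (mul_nonneg hM0 hN0)
  rw [← add_eq_zero_iff_eq_neg, ← abs_nonpos_iff]
  refine le_of_forall_pos_le_add fun δ hδ => ?_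
  -- The added 1 keeps the denominator positive even if the constant vanishes.
  refine (bound (δ / ((∫ x, |D x| ∂μ) + max M 0 * N + 1)) (by positivity)).trans ?_
  rw [zero_add, div_mul_eq_mul_div, div_le_iff₀ (by positivity)]
  nlinarith

end Radial

/-! ### Algebra of the matrices a I + s y yᵀ -/

namespace Matrix

variable {n : ℕ}

/-- The matrix `a I + s y yᵀ`. -/
def scalarAddRankOne (a s : ℝ) (y : Fin n → ℝ) : Matrix (Fin n) (Fin n) ℝ :=
  a • (1 : Matrix (Fin n) (Fin n) ℝ) + s • vecMulVec y y

theorem scalarAddRankOne_apply (a s : ℝ) (y : Fin n → ℝ) (i j : Fin n) :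
    scalarAddRankOne a s y i j = a * (if i = j then 1 else 0) + s * (y i * y j) := by
  simp [scalarAddRankOne, vecMulVec_apply, one_apply]

theorem scalarAddRankOne_mul (a s b t : ℝ) (y : Fin n → ℝ) :
    scalarAddRankOne a s y * scalarAddRankOne b t y =
      scalarAddRankOne (a * b) (a * t + s * b + s * t * (y ⬝ᵥ y)) y := by
  ext i j
  simp only [scalarAddRankOne, add_mul, mul_add, smul_mul_assoc, mul_smul_comm, one_mul, mul_one,
    vecMulVec_mul_vecMulVec, add_apply, smul_apply, vecMulVec_apply, one_apply, smul_eq_mul,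
    Pi.smul_apply]
  ring

theorem continuous_scalarAddRankOne (s : ℝ) (y : Fin n → ℝ) :
    Continuous fun a => scalarAddRankOne a s y := by
  unfold scalarAddRankOne
  fun_prop

/-- For a ≠ 0 this is the matrix determinant lemma; both sides are continuous in a, so a = 0 follows
by density. -/
theorem det_scalarAddRankOne (hn : 1 ≤ n) (a s : ℝ) (y : Fin n → ℝ) :
    (scalarAddRankOne a s y).det = a ^ (n - 1) * (a + s * (y ⬝ᵥ y)) := by
  have hd : Dense ({0}ᶜ : Set ℝ) := dense_compl_singleton 0
  have hc : Continuous fun a : ℝ => a ^ (n - 1) * (a + s * (y ⬝ᵥ y)) := by fun_prop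
  refine congrFun (Continuous.ext_on hd (continuous_scalarAddRankOne s y).matrix_det
    hc fun a ha => ?_) a
  have ha : a ≠ 0 := ha
  have e : scalarAddRankOne a s y = a • (1 + vecMulVec ((s / a) • y) y) := by
    ext i j
    simp [scalarAddRankOne, vecMulVec_apply]
    field_simp
  obtain ⟨m, rfl⟩ : ∃ m, n = m + 1 := ⟨n - 1, by omega⟩
  rw [e, det_smul, vecMulVec_eq Unit, det_one_add_replicateCol_mul_replicateRow]
  simp [pow_succ]
  field_simp

/-- The product with a I + s y yᵀ of the matrix on the right is scalar, so multiplying by the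
adjugate and cancelling settles all but two values of a; density covers those. -/
theorem adjugate_scalarAddRankOne (hn : 2 ≤ n) (a s : ℝ) (y : Fin n → ℝ) :
    (scalarAddRankOne a s y).adjugate =
      a ^ (n - 2) • scalarAddRankOne (a + s * (y ⬝ᵥ y)) (-s) y := by
  have hd : Dense ({0, -(s * (y ⬝ᵥ y))}ᶜ : Set ℝ) :=
    ((Set.finite_singleton _).insert _).countable.dense_compl ℝ
  have hc : Continuous fun a => a ^ (n - 2) • scalarAddRankOne (a + s * (y ⬝ᵥ y)) (-s) y :=
    (continuous_pow _).smul ((continuous_scalarAddRankOne (-s) y).comp (by fun_prop))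
  refine congrFun (Continuous.ext_on hd (continuous_scalarAddRankOne s y).matrix_adjugate
    hc fun a ha => ?_) a
  simp only [mem_compl_iff, mem_insert_iff, mem_singleton_iff, not_or] at ha
  have h2 : a + s * (y ⬝ᵥ y) ≠ 0 := fun h => ha.2 (by linarith)
  have h1 : scalarAddRankOne a s y * scalarAddRankOne (a + s * (y ⬝ᵥ y)) (-s) y =
      (a * (a + s * (y ⬝ᵥ y))) • (1 : Matrix (Fin n) (Fin n) ℝ) := by
    rw [scalarAddRankOne_mul, scalarAddRankOne,
      show a * -s + s * (a + s * (y ⬝ᵥ y)) + s * -s * (y ⬝ᵥ y) = 0 by ring, zero_smul, add_zero]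
  have h3 := congrArg (fun X => (scalarAddRankOne a s y).adjugate * X) h1
  simp only [← mul_assoc, adjugate_mul, smul_mul_assoc, one_mul, mul_smul_comm, mul_one,
    det_scalarAddRankOne (by omega : 1 ≤ n)] at h3
  have h4 : a * (a + s * (y ⬝ᵥ y)) ≠ 0 := mul_ne_zero ha.1 h2
  refine smul_right_injective _ h4 ?_
  simp only
  rw [← h3, smul_smul]
  congr 1
  obtain ⟨m, rfl⟩ : ∃ m, n = m + 2 := ⟨n - 2, by omega⟩
  simp [pow_succ]
  ring

theorem scalarAddRankOne_transpose (a s : ℝ) (y : Fin n → ℝ) :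
    (scalarAddRankOne a s y).transpose = scalarAddRankOne a s y := by
  ext i j
  simp only [transpose_apply, scalarAddRankOne_apply, eq_comm (a := j)]
  ring

theorem cof_scalarAddRankOne (hn : 2 ≤ n) (a s : ℝ) (y : Fin n → ℝ) :
    (scalarAddRankOne a s y).cof =
      a ^ (n - 2) • scalarAddRankOne (a + s * (y ⬝ᵥ y)) (-s) y := by
  rw [cof, adjugate_scalarAddRankOne hn, transpose_smul, scalarAddRankOne_transpose]

theorem frob_smul_left (c : ℝ) (A B : Matrix (Fin n) (Fin n) ℝ) :
    (c • A).frob B = c * A.frob B := by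
  simp [frob, Finset.mul_sum, mul_assoc]

/-- These matrices are symmetric, so A : B is the trace of A B. -/
theorem frob_scalarAddRankOne (a s b t : ℝ) (y : Fin n → ℝ) :
    (scalarAddRankOne a s y).frob (scalarAddRankOne b t y) =
      n * (a * b) + (a * t + s * b + s * t * (y ⬝ᵥ y)) * (y ⬝ᵥ y) := by
  have h : (scalarAddRankOne a s y).frob (scalarAddRankOne b t y) =
      (scalarAddRankOne a s y * scalarAddRankOne b t y).trace := by
    rw [frob, trace]
    refine Finset.sum_congr rfl fun i _ => ?_
    rw [diag_apply, mul_apply]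
    refine Finset.sum_congr rfl fun j _ => ?_
    rw [← transpose_apply (scalarAddRankOne b t y) j i, scalarAddRankOne_transpose]
  rw [h, scalarAddRankOne_mul, scalarAddRankOne, trace_add, trace_smul, trace_smul,
    trace_vecMulVec, trace_one]
  simp
  ring

end Matrix

theorem EuclideanSpace.dotProduct_self_eq {n : ℕ} (x : EuclideanSpace ℝ (Fin n)) :
    x.ofLp ⬝ᵥ x.ofLp = ‖x‖ ^ 2 := by
  rw [EuclideanSpace.norm_sq_eq]
  simp [dotProduct, sq]

/-! ### The weak Jacobian of a radial map -/

section Jacobian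

variable {n : ℕ} [NeZero n]

theorem IsPrimitiveOn.locallyIntegrableOn_scalarAddRankOne {Φ w : ℝ → ℝ}
    (hΦ : IsPrimitiveOn Φ w (Ioo 0 1)) (i j : Fin n) : LocallyIntegrableOn
      (fun x : EuclideanSpace ℝ (Fin n) =>
        Matrix.scalarAddRankOne (Φ ‖x‖) (w ‖x‖ / ‖x‖) x.ofLp i j) (Metric.ball 0 1 \ {0}) := by
  have hU : IsOpen (Metric.ball (0 : EuclideanSpace ℝ (Fin n)) 1 \ {0}) :=
    Metric.isOpen_ball.sdiff isClosed_singleton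
  rw [locallyIntegrableOn_iff hU.isLocallyClosed]
  intro K hKU hK
  obtain ⟨a, b, ha, hab, hb, hsub⟩ := exists_annulus_of_isCompact hK hKU
  refine IntegrableOn.mono_set ?_ hsub
  have hA : IsCompact {x : EuclideanSpace ℝ (Fin n) | ‖x‖ ∈ Icc a b} :=
    isCompact_norm_preimage_Icc a b
  have hw : IntegrableOn w (Icc a b) :=
    (intervalIntegrable_iff_integrableOn_Icc_of_le hab.le).mp
      (hΦ a ⟨ha, hab.trans hb⟩ b ⟨ha.trans hab, hb⟩).1
  have hΦi : IntegrableOn Φ (Icc a b) :=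
    (hΦ.continuousOn_Ioo.mono (Icc_subset_Ioo ha hb)).integrableOn_compact isCompact_Icc
  have i1 := (integrableOn_norm_comp (E := EuclideanSpace ℝ (Fin n)) volume ha hΦi).mul_const
    (if i = j then (1 : ℝ) else 0)
  have i2 := IntegrableOn.mul_continuousOn
    (integrableOn_norm_comp (E := EuclideanSpace ℝ (Fin n)) volume ha hw)
    (g' := fun x : EuclideanSpace ℝ (Fin n) => ‖x‖⁻¹ * (x i * x j))
    ((continuous_norm.continuousOn.inv₀ fun x hx => (ha.trans_le hx.1).ne').mul
      (by fun_prop)) hA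
  refine (i1.add i2).congr (.of_forall fun x => ?_)
  simp only [Matrix.scalarAddRankOne_apply, Pi.add_apply, div_eq_mul_inv, mul_assoc]

/-- Both matrices act identically on test functions supported off the origin, and a single point is
null. -/
theorem HasWeakJacobian.ae_eq_scalarAddRankOne {φ Φ w : ℝ → ℝ}
    {Du : EuclideanSpace ℝ (Fin n) → Matrix (Fin n) (Fin n) ℝ}
    (hu : HasWeakJacobian (Metric.ball 0 1) (fun x => φ ‖x‖ • x) Du)
    (hφ : ∀ᵐ r, r ∈ Ioo (0 : ℝ) 1 → φ r = Φ r) (hΦ : IsPrimitiveOn Φ w (Ioo 0 1)) :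
    ∀ᵐ x, x ∈ Metric.ball (0 : EuclideanSpace ℝ (Fin n)) 1 →
      Du x = Matrix.scalarAddRankOne (Φ ‖x‖) (w ‖x‖ / ‖x‖) x.ofLp := by
  set U : Set (EuclideanSpace ℝ (Fin n)) := Metric.ball 0 1 \ {0}
  have hU : IsOpen U := Metric.isOpen_ball.sdiff isClosed_singleton
  have hcand := hΦ.locallyIntegrableOn_scalarAddRankOne (n := n)
  have key : ∀ i j, ∀ᵐ x, x ∈ U →
      Du x i j = Matrix.scalarAddRankOne (Φ ‖x‖) (w ‖x‖ / ‖x‖) x.ofLp i j := by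
    intro i j
    have hDu : LocallyIntegrableOn (fun x => Du x i j) U :=
      ((hu.2 i j).1.locallyIntegrableOn Metric.isOpen_ball le_rfl).mono_set sdiff_subset
    have := hU.ae_eq_zero_of_integral_contDiff_smul_eq_zero (hDu.sub (hcand i j)) ?_
    · filter_upwards [this] with x hx hxU
      exact sub_eq_zero.mp (hx hxU)
    intro η hη hηc hηs
    have hηd : Differentiable ℝ η := hη.differentiable (by simp)
    have hηB : tsupport η ⊆ Metric.ball 0 1 := hηs.trans sdiff_subset
    have hξs : tsupport (fun x : EuclideanSpace ℝ (Fin n) => x i * η x) ⊆ tsupport η :=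
      tsupport_mul_subset_right
    have hfd : ∀ x, fderiv ℝ (fun x : EuclideanSpace ℝ (Fin n) => x i * η x) x
        (EuclideanSpace.single j 1) =
          x i * fderiv ℝ η x (EuclideanSpace.single j 1) + (if i = j then 1 else 0) * η x := by
      intro x
      have h1 : HasFDerivAt (fun x : EuclideanSpace ℝ (Fin n) => x i)
        (EuclideanSpace.proj i : EuclideanSpace ℝ (Fin n) →L[ℝ] ℝ) x :=
        (EuclideanSpace.proj i : EuclideanSpace ℝ (Fin n) →L[ℝ] ℝ).hasFDerivAt
      rw [(h1.fun_mul (hηd x).hasFDerivAt).fderiv]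
      simp
    -- The factor xᵢ of uᵢ = φ xᵢ is moved onto the test function; its derivative produces the δᵢⱼ
    -- term.
    have e1 := hΦ.integral_norm_comp_mul_fderiv volume
      (ξ := fun x : EuclideanSpace ℝ (Fin n) => x i * η x)
      ((by fun_prop : ContDiff ℝ 1 fun x : EuclideanSpace ℝ (Fin n) => x i).mul
        (hη.of_le (by simp))) (hηc.mul_left) (hξs.trans hηs) (EuclideanSpace.single j 1)
    have e2 := (hu.2 i j).2 η hη hηc hηB
    have hder : ∀ x ∉ Metric.ball (0 : EuclideanSpace ℝ (Fin n)) 1, fderiv ℝ η x = 0 :=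
      fun x hx => fderiv_of_notMem_tsupport (𝕜 := ℝ) fun h => hx (hηB h)
    rw [setIntegral_mul_eq_integral_of_tsupport_subset hηB,
      setIntegral_eq_integral_of_forall_compl_eq_zero (fun x hx => by rw [hder x hx]; simp)] at e2
    have hΦφ : ∀ᵐ x : EuclideanSpace ℝ (Fin n), x ≠ 0 → ‖x‖ ∈ Ioo (0 : ℝ) 1 → φ ‖x‖ = Φ ‖x‖ :=
      ae_norm_of_ae_pos volume (p := fun r => r ∈ Ioo (0 : ℝ) 1 → φ r = Φ r)
        (by filter_upwards [hφ] with r hr _ using hr)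
    have e3 : ∫ x, (φ ‖x‖ • x) i * fderiv ℝ η x (EuclideanSpace.single j 1) =
        ∫ x, Φ ‖x‖ * (x i * fderiv ℝ η x (EuclideanSpace.single j 1)) := by
      refine integral_congr_ae ?_
      filter_upwards [hΦφ] with x hx
      by_cases hxU : x ∈ tsupport η
      · have := hηs hxU
        rw [PiLp.smul_apply, smul_eq_mul, hx this.2 ⟨norm_pos_iff.mpr this.2,
          by simpa using this.1⟩, mul_assoc]
      · rw [fderiv_of_notMem_tsupport (𝕜 := ℝ) hxU]
        simp
    rw [e3] at e2
    have hΦl : LocallyIntegrableOn (fun x : EuclideanSpace ℝ (Fin n) => Φ ‖x‖) U := by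
      refine ContinuousOn.locallyIntegrableOn ?_ hU.measurableSet
      exact hΦ.continuousOn_Ioo.comp continuous_norm.continuousOn fun x hx =>
        ⟨norm_pos_iff.mpr hx.2, by simpa using hx.1⟩
    have hηc1 : Continuous fun x => fderiv ℝ η x (EuclideanSpace.single j 1) :=
      (hη.continuous_fderiv_apply (by simp)).comp (continuous_id.prodMk continuous_const)
    have hΦi : IntegrableOn (fun x : EuclideanSpace ℝ (Fin n) => Φ ‖x‖) (tsupport η) :=
      hΦl.integrableOn_compact_subset hηs hηc
    have hxi : Continuous fun x : EuclideanSpace ℝ (Fin n) => x i := by fun_prop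
    have j1 : Integrable fun x : EuclideanSpace ℝ (Fin n) =>
        Φ ‖x‖ * (x i * fderiv ℝ η x (EuclideanSpace.single j 1)) := by
      refine IntegrableOn.integrable_mul_of_support_subset hΦi
        (hxi.mul hηc1).continuousOn hηc fun x hx => ?_
      by_contra h
      exact hx (by simp [fderiv_of_notMem_tsupport (𝕜 := ℝ) h])
    have j2 : Integrable fun x : EuclideanSpace ℝ (Fin n) =>
        Φ ‖x‖ * ((if i = j then (1 : ℝ) else 0) * η x) :=
      IntegrableOn.integrable_mul_of_support_subset hΦi
        (continuous_const.mul hη.continuous).continuousOn hηc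
        fun x hx => subset_tsupport _ (right_ne_zero_of_mul hx)
    have j3 := LocallyIntegrableOn.integrable_mul_of_tsupport_subset hDu hη.continuous hηc hηs
    have j4 := LocallyIntegrableOn.integrable_mul_of_tsupport_subset (hcand i j) hη.continuous
      hηc hηs
    simp only [hfd, mul_add] at e1
    rw [integral_add j1 j2, e2] at e1
    have e4 : ∫ x, Matrix.scalarAddRankOne (Φ ‖x‖) (w ‖x‖ / ‖x‖) x.ofLp i j * η x =
        (∫ x : EuclideanSpace ℝ (Fin n), Φ ‖x‖ * ((if i = j then (1 : ℝ) else 0) * η x)) +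
        ∫ x, w ‖x‖ * (inner ℝ x (EuclideanSpace.single j 1) / ‖x‖ * (x i * η x)) := by
      rw [← sub_eq_iff_eq_add', ← integral_sub j4 j2]
      refine integral_congr_ae (.of_forall fun x => ?_)
      simp only [Matrix.scalarAddRankOne_apply, EuclideanSpace.inner_single_right]
      simp only [one_mul, conj_trivial]
      ring
    have e5 : ∫ x, η x • ((fun x => Du x i j) - fun x : EuclideanSpace ℝ (Fin n) =>
        Matrix.scalarAddRankOne (Φ ‖x‖) (w ‖x‖ / ‖x‖) x.ofLp i j) x =
        (∫ x, Du x i j * η x) -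
          ∫ x, Matrix.scalarAddRankOne (Φ ‖x‖) (w ‖x‖ / ‖x‖) x.ofLp i j * η x := by
      rw [← integral_sub j3 j4]
      refine integral_congr_ae (.of_forall fun x => ?_)
      simp only [Pi.sub_apply, smul_eq_mul]
      ring
    rw [e5, e4]
    linarith
  have h0 : ∀ᵐ x : EuclideanSpace ℝ (Fin n), x ≠ 0 := Measure.ae_ne volume 0
  have hall := ae_all_iff.mpr fun i => ae_all_iff.mpr fun j => key i j
  filter_upwards [hall, h0] with x hx hx0 hxB
  ext i j
  exact hx i j ⟨hxB, hx0⟩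

end Jacobian

/-! ### Reduction of the system to one radial equation -/

section RadialField

variable {n : ℕ}

theorem tsupport_norm_smul_subset {E : Type*} [NormedAddCommGroup E] [NormedSpace ℝ E]
    {η : ℝ → ℝ} {a b : ℝ} (hs : tsupport η ⊆ Ioo a b) :
    tsupport (fun x : E => η ‖x‖ • x) ⊆ {x : E | ‖x‖ ∈ Icc a b} := by
  refine closure_minimal (fun x hx => ?_) (isClosed_Icc.preimage continuous_norm)
  by_contra h
  refine hx ?_
  simp [image_eq_zero_of_notMem_tsupport fun h' => h (Ioo_subset_Icc_self (hs h'))]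

theorem contDiff_norm_smul {E : Type*} [NormedAddCommGroup E] [InnerProductSpace ℝ E]
    {η : ℝ → ℝ} (hη : ContDiff ℝ 1 η) {a b : ℝ} (ha : 0 < a) (hs : tsupport η ⊆ Ioo a b) :
    ContDiff ℝ 1 (fun x : E => η ‖x‖ • x) := by
  rw [contDiff_iff_contDiffAt]
  intro x
  by_cases hx : x = 0
  · have : x ∉ tsupport (fun x : E => η ‖x‖ • x) := fun h => by
      have := (tsupport_norm_smul_subset hs h).1
      simp [hx] at this
      linarith
    exact contDiffAt_const.congr_of_eventuallyEq (notMem_tsupport_iff_eventuallyEq.mp this)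
  · exact (hη.contDiffAt.comp x (contDiffAt_norm ℝ hx)).smul contDiffAt_id

theorem jacobian_norm_smul {η : ℝ → ℝ} (hη : Differentiable ℝ η) {x : EuclideanSpace ℝ (Fin n)}
    (hx : x ≠ 0) : jacobian (fun x => η ‖x‖ • x) x =
      Matrix.scalarAddRankOne (η ‖x‖) (deriv η ‖x‖ / ‖x‖) x.ofLp := by
  have h1 := ((hη ‖x‖).hasDerivAt.comp_hasFDerivAt x (hasFDerivAt_norm_of_ne_zero hx)).smul
    (hasFDerivAt_id x)
  ext i j
  have h2 : fderiv ℝ (fun x : EuclideanSpace ℝ (Fin n) => η ‖x‖ • x) x = _ := h1.fderiv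
  rw [jacobian, Matrix.of_apply, h2, Matrix.scalarAddRankOne_apply]
  simp [EuclideanSpace.inner_single_right]
  ring

theorem Matrix.frob_cof_scalarAddRankOne (hn : 2 ≤ n) (a s b t : ℝ) (y : Fin n → ℝ) :
    (scalarAddRankOne a s y).cof.frob (scalarAddRankOne b t y) =
      a ^ (n - 2) * ((n - 1) * b * (a + s * (y ⬝ᵥ y)) + a * (b + t * (y ⬝ᵥ y))) := by
  rw [cof_scalarAddRankOne hn, frob_smul_left, frob_scalarAddRankOne]
  ring

theorem stress_frob_of_eq_scalarAddRankOne (hn : 2 ≤ n) (h : ℝ → ℝ)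
    {Du : EuclideanSpace ℝ (Fin n) → Matrix (Fin n) (Fin n) ℝ} {x : EuclideanSpace ℝ (Fin n)}
    (hx : x ≠ 0) {a w : ℝ} (hD : Du x = Matrix.scalarAddRankOne a (w / ‖x‖) x.ofLp) (b t : ℝ) :
    (stress h Du x).frob (Matrix.scalarAddRankOne b t x.ofLp) =
      h (a ^ (n - 1) * (a + ‖x‖ * w)) * a ^ (n - 2) *
        ((n - 1) * b * (a + ‖x‖ * w) + a * (b + t * ‖x‖ ^ 2)) := by
  have h0 : ‖x‖ ≠ 0 := norm_ne_zero_iff.mpr hx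
  have h1 : w / ‖x‖ * ‖x‖ ^ 2 = ‖x‖ * w := by field_simp
  rw [stress, Matrix.frob_smul_left, hD, Matrix.frob_cof_scalarAddRankOne hn,
    Matrix.det_scalarAddRankOne (by omega), EuclideanSpace.dotProduct_self_eq, h1]
  ring

theorem integrableOn_frob {σ T : EuclideanSpace ℝ (Fin n) → Matrix (Fin n) (Fin n) ℝ}
    {K : Set (EuclideanSpace ℝ (Fin n))} (hK : IsCompact K)
    (hσ : ∀ i j, IntegrableOn (fun x => σ x i j) K) (hT : ∀ i j, Continuous fun x => T x i j) :
    IntegrableOn (fun x => (σ x).frob (T x)) K := by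
  unfold Matrix.frob
  refine integrable_finsetSum _ fun i _ => integrable_finsetSum _ fun j _ => ?_
  exact (hσ i j).mul_continuousOn (hT i j).continuousOn hK

variable {Φ w h : ℝ → ℝ} {Du : EuclideanSpace ℝ (Fin n) → Matrix (Fin n) (Fin n) ℝ}

/-- The stress is paired with b I + t x xᵀ, which has continuous entries; the constants b and t are
free so that the two terms of the radial equation can be shown integrable separately. -/
theorem locallyIntegrableOn_radial_stress (hn : 2 ≤ n)
    (hD : ∀ᵐ x, x ∈ Metric.ball (0 : EuclideanSpace ℝ (Fin n)) 1 →
      Du x = Matrix.scalarAddRankOne (Φ ‖x‖) (w ‖x‖ / ‖x‖) x.ofLp)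
    (hσ : MatrixMemLpLoc (stress h Du) 1 (Metric.ball 0 1)) (b t : ℝ) :
    LocallyIntegrableOn (fun r => r ^ (n - 1) * (h (Φ r ^ (n - 1) * (Φ r + r * w r)) *
      Φ r ^ (n - 2) * ((n - 1) * b * (Φ r + r * w r) + Φ r * (b + t * r ^ 2)))) (Ioo 0 1) := by
  have : NeZero n := ⟨by omega⟩
  rw [locallyIntegrableOn_iff isOpen_Ioo.isLocallyClosed]
  intro K hKs hK
  obtain ⟨α, β, ha, hab, hb, hKI⟩ := exists_Ioo_of_isCompact_subset_Ioo hK one_pos hKs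
  refine IntegrableOn.mono_set ?_ (hKI.trans Ioo_subset_Icc_self)
  set A := {x : EuclideanSpace ℝ (Fin n) | ‖x‖ ∈ Icc α β}
  have hA : IsCompact A := isCompact_norm_preimage_Icc α β
  have hAB : A ⊆ Metric.ball 0 1 := fun x hx => by simpa using hx.2.trans_lt hb
  have h1 : IntegrableOn (fun x => (stress h Du x).frob
      (Matrix.scalarAddRankOne b t x.ofLp)) A :=
    integrableOn_frob hA (fun i j => memLp_one_iff_integrable.mp (hσ i j A hA hAB)) fun i j => by
      simp only [Matrix.scalarAddRankOne_apply]
      fun_prop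
  have h2 := (integrableOn_norm_comp_iff (E := EuclideanSpace ℝ (Fin n)) volume
    (F := fun r => h (Φ r ^ (n - 1) * (Φ r + r * w r)) * Φ r ^ (n - 2) *
      ((n - 1) * b * (Φ r + r * w r) + Φ r * (b + t * r ^ 2))) (b := β) ha).mp ?_
  · simpa using h2
  refine h1.congr ?_
  filter_upwards [ae_restrict_of_ae hD, ae_restrict_mem hA.measurableSet] with x hx hxA
  rw [stress_frob_of_eq_scalarAddRankOne hn h (norm_pos_iff.mp (ha.trans_le hxA.1))
    (hx (hAB hxA))]

/-- The equation tested with ζ = η(|x|) x, which is C¹ because η vanishes near 0. The area of the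
unit sphere factors out. -/
theorem integral_radial_stress_eq_zero (hn : 2 ≤ n)
    (hD : ∀ᵐ x, x ∈ Metric.ball (0 : EuclideanSpace ℝ (Fin n)) 1 →
      Du x = Matrix.scalarAddRankOne (Φ ‖x‖) (w ‖x‖ / ‖x‖) x.ofLp)
    (hw : ∀ ζ : EuclideanSpace ℝ (Fin n) → EuclideanSpace ℝ (Fin n),
      ContDiff ℝ 1 ζ → HasCompactSupport ζ → tsupport ζ ⊆ Metric.ball 0 1 →
      ∫ x in Metric.ball 0 1, (stress h Du x).frob (jacobian ζ x) = 0)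
    {η : ℝ → ℝ} (hη : ContDiff ℝ 1 η) (hc : HasCompactSupport η) (hs : tsupport η ⊆ Ioo 0 1) :
    ∫ r, r ^ (n - 1) * (h (Φ r ^ (n - 1) * (Φ r + r * w r)) * Φ r ^ (n - 2) *
      ((n - 1) * η r * (Φ r + r * w r) + Φ r * (η r + r * deriv η r))) = 0 := by
  have : NeZero n := ⟨by omega⟩
  obtain ⟨α, β, ha, hab, hb, hI⟩ := exists_Ioo_of_isCompact_subset_Ioo hc one_pos hs
  have hts := tsupport_norm_smul_subset (E := EuclideanSpace ℝ (Fin n)) hI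
  have h1 := hw (fun x => η ‖x‖ • x) (contDiff_norm_smul hη ha hI)
    ((isCompact_norm_preimage_Icc α β).of_isClosed_subset (isClosed_tsupport _) hts)
    (hts.trans fun x hx => by simpa using hx.2.trans_lt hb)
  set R : ℝ → ℝ := fun r => h (Φ r ^ (n - 1) * (Φ r + r * w r)) * Φ r ^ (n - 2) *
      ((n - 1) * η r * (Φ r + r * w r) + Φ r * (η r + r * deriv η r))
  have hR : ∀ r ∉ Ioo (0 : ℝ) 1, R r = 0 := fun r hr => by
    have h2 : η r = 0 := image_eq_zero_of_notMem_tsupport fun h => hr (hs h)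
    have h3 : deriv η r = 0 := image_eq_zero_of_notMem_tsupport fun h =>
      hr (hs (tsupport_deriv_subset h))
    simp [R, h2, h3]
  have h4 : ∫ x in Metric.ball (0 : EuclideanSpace ℝ (Fin n)) 1, R ‖x‖ = 0 := by
    rw [← h1]
    refine integral_congr_ae ?_
    filter_upwards [ae_restrict_of_ae hD, ae_restrict_mem Metric.isOpen_ball.measurableSet,
      ae_restrict_of_ae (Measure.ae_ne volume 0)] with x hx hxB hx0
    have h0 : ‖x‖ ≠ 0 := norm_ne_zero_iff.mpr hx0
    rw [jacobian_norm_smul (hη.differentiable one_ne_zero) hx0,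
      stress_frob_of_eq_scalarAddRankOne hn h hx0 (hx hxB)]
    simp only [R]
    field_simp
  rw [setIntegral_eq_integral_of_forall_compl_eq_zero (fun x hx => hR _ fun h => hx
    (by simpa using h.2)), integral_fun_norm_addHaar] at h4
  have h5 : volume.real (Metric.ball (0 : EuclideanSpace ℝ (Fin n)) 1) ≠ 0 :=
    (ENNReal.toReal_pos (Metric.measure_ball_pos _ _ one_pos).ne' measure_ball_lt_top.ne).ne'
  simp only [finrank_euclideanSpace_fin, nsmul_eq_mul, smul_eq_mul, mul_eq_zero, h5,
    Nat.cast_eq_zero, NeZero.ne n, false_or] at h4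
  rwa [setIntegral_eq_integral_of_forall_compl_eq_zero] at h4
  exact fun r hr => by rw [hR r fun h => hr h.1, mul_zero]

/-- With P = r^n Φ^(n-1) and H = h(det Du), the tested equation says that H P has weak derivative H
P'; no derivative of H enters. -/
theorem IsWeakSolution.exists_isPrimitiveOn (hn : 2 ≤ n) {φ : ℝ → ℝ}
    (hφ : ∀ᵐ r, r ∈ Ioo (0 : ℝ) 1 → φ r = Φ r) (hΦ : IsPrimitiveOn Φ w (Ioo 0 1))
    (hu : IsWeakSolution h (Metric.ball 0 1) (fun x => φ ‖x‖ • x) Du) :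
    ∃ F, IsPrimitiveOn F (fun r => h (Φ r ^ (n - 1) * (Φ r + r * w r)) *
        (n * r ^ (n - 1) * Φ r ^ (n - 1) + r ^ n * ((n - 1) * Φ r ^ (n - 2) * w r))) (Ioo 0 1) ∧
      ∀ᵐ r, r ∈ Ioo (0 : ℝ) 1 →
        h (Φ r ^ (n - 1) * (Φ r + r * w r)) * (r ^ n * Φ r ^ (n - 1)) = F r := by
  have : NeZero n := ⟨by omega⟩
  have hD := hu.1.ae_eq_scalarAddRankOne hφ hΦ
  obtain ⟨m, rfl⟩ : ∃ m, n = m + 2 := ⟨n - 2, by omega⟩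
  have hf : LocallyIntegrableOn (fun r => h (Φ r ^ (m + 1) * (Φ r + r * w r)) *
      (r ^ (m + 2) * Φ r ^ (m + 1))) (Ioo 0 1) := by
    -- The choice b = 0, t = 1 gives r H P, whence the factor r⁻¹; below, b = 1, t = 0 gives H P'.
    have := locallyIntegrableOn_radial_stress hn hD hu.2.1 0 1
    have h1 := this.mul_continuousOn (g := fun r => r⁻¹)
      (continuousOn_id.inv₀ fun r hr => hr.1.ne') isOpen_Ioo.isLocallyClosed
    refine LocallyIntegrableOn.congr ?_ h1
    filter_upwards [ae_restrict_mem measurableSet_Ioo] with r hr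
    have h0 : r ≠ 0 := hr.1.ne'
    simp
    field_simp
    ring
  have hg : LocallyIntegrableOn (fun r => h (Φ r ^ (m + 1) * (Φ r + r * w r)) *
      ((m + 2 : ℕ) * r ^ (m + 1) * Φ r ^ (m + 1) +
        r ^ (m + 2) * (((m + 2 : ℕ) - 1) * Φ r ^ m * w r))) (Ioo 0 1) := by
    have := locallyIntegrableOn_radial_stress hn hD hu.2.1 1 0
    convert! this using 1
    ext r
    simp
    ring
  refine exists_isPrimitiveOn_of_weakDeriv one_pos hf hg fun η h1 h2 h3 => ?_
  have h1' : ContDiff ℝ 1 η := h1.of_le (by simp)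
  have h4 := integral_radial_stress_eq_zero hn hD hu.2.2 h1' h2 h3
  have i1 := LocallyIntegrableOn.integrable_mul_of_tsupport_subset hf
    (h1'.continuous_deriv le_rfl) h2.deriv (tsupport_deriv_subset.trans h3)
  have i2 := LocallyIntegrableOn.integrable_mul_of_tsupport_subset hg h1.continuous h2 h3
  rw [← add_eq_zero_iff_eq_neg]
  refine (integral_add i1 i2).symm.trans (Eq.trans ?_ h4)
  refine integral_congr_ae (.of_forall fun r => ?_)
  simp
  ring

end RadialField

/-! ### Solving the radial equation and excluding zeros -/

section Profile

variable {n : ℕ} {Φ w F h : ℝ → ℝ}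

/-- Where Φ ≠ 0, dividing F by P = r^n Φ^(n-1) shows that h(det Du) is constant. Injectivity of h
then fixes det Du, and one integration gives the formula. -/
theorem exists_pow_eq_of_ne_zero (hn : 2 ≤ n) (h_inj : Function.Injective h)
    (hΦ : IsPrimitiveOn Φ w (Ioo 0 1))
    (hF : IsPrimitiveOn F (fun r => h (Φ r ^ (n - 1) * (Φ r + r * w r)) *
        (n * r ^ (n - 1) * Φ r ^ (n - 1) + r ^ n * ((n - 1) * Φ r ^ (n - 2) * w r))) (Ioo 0 1))
    (hFe : ∀ᵐ r, r ∈ Ioo (0 : ℝ) 1 →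
        h (Φ r ^ (n - 1) * (Φ r + r * w r)) * (r ^ n * Φ r ^ (n - 1)) = F r)
    {s t : ℝ} (hs : 0 ≤ s) (hst : s < t) (ht : t ≤ 1) (h0 : ∀ r ∈ Ioo s t, Φ r ≠ 0) :
    ∃ l c : ℝ, (∀ r ∈ Ioo s t, r ^ n * Φ r ^ n = l * r ^ n + c) ∧
      ∀ᵐ r, r ∈ Ioo s t → Φ r ^ (n - 1) * (Φ r + r * w r) = l := by
  obtain ⟨m, rfl⟩ : ∃ m, n = m + 2 := ⟨n - 2, by omega⟩
  simp only [show m + 2 - 1 = m + 1 by omega, Nat.add_sub_cancel] at *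
  have hsub : Ioo s t ⊆ Ioo 0 1 := Ioo_subset_Ioo hs ht
  have hr0 : ∀ r ∈ Ioo s t, r ≠ 0 := fun r hr => (hsub hr).1.ne'
  have hΦac : ∀ a ∈ Ioo s t, ∀ b ∈ Ioo s t, AbsolutelyContinuousOnInterval Φ a b :=
    fun a ha b hb => hΦ.absolutelyContinuousOnInterval (hsub ha) (hsub hb)
  have hquot : ∀ a ∈ Ioo s t, ∀ b ∈ Ioo s t, AbsolutelyContinuousOnInterval
      (fun r => F r * (r ^ (m + 2) * Φ r ^ (m + 1))⁻¹) a b := by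
    intro a ha b hb
    refine (hF.absolutelyContinuousOnInterval (hsub ha) (hsub hb)).fun_mul
      ((((absolutelyContinuousOnInterval_id a b).fun_pow _).fun_mul
        ((hΦac a ha b hb).fun_pow _)).fun_inv fun x hx => ?_)
    have hxI := ordConnected_Ioo.uIcc_subset ha hb hx
    exact mul_ne_zero (pow_ne_zero _ (hr0 x hxI)) (pow_ne_zero _ (h0 x hxI))
  obtain ⟨C, hC⟩ := exists_const_on_Ioo_of_ae_hasDerivAt_zero hquot (by
    filter_upwards [hΦ.ae_hasDerivAt, hF.ae_hasDerivAt, hFe] with r h1 h2 h3 hr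
    have hrI := hsub hr
    have hr1 := hr0 r hr
    have hr2 := h0 r hr
    have h4 := ((hasDerivAt_id r).fun_pow (m + 2)).fun_mul ((h1 hrI).fun_pow (m + 1))
    have h5 := (h2 hrI).fun_mul (h4.fun_inv
      (mul_ne_zero (pow_ne_zero _ hr1) (pow_ne_zero _ hr2)))
    refine h5.congr_deriv ?_
    -- Substituting F = H P into the quotient rule, with F' = H P', makes the numerator F' P - F P'
    -- vanish.
    rw [← h3 hrI]
    simp
    field_simp
    ring)
  have hdet : ∀ᵐ r, r ∈ Ioo s t → h (Φ r ^ (m + 1) * (Φ r + r * w r)) = C := by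
    filter_upwards [hFe] with r h3 hr
    have hne : r ^ (m + 2) * Φ r ^ (m + 1) ≠ 0 :=
      mul_ne_zero (pow_ne_zero _ (hr0 r hr)) (pow_ne_zero _ (h0 r hr))
    rw [← hC r hr, ← h3 (hsub hr), mul_assoc, mul_inv_cancel₀ hne, mul_one]
  -- The interval has positive measure, so some radius attains C; its determinant value serves as l.
  obtain ⟨r₀, -, hr₀⟩ : ∃ r₀ ∈ Ioo s t, h (Φ r₀ ^ (m + 1) * (Φ r₀ + r₀ * w r₀)) = C := by
    by_contra! hcon
    have hz : ∀ᵐ r, r ∉ Ioo s t := by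
      filter_upwards [hdet] with r hr hrI using hcon r hrI (hr hrI)
    have := measure_eq_zero_iff_ae_notMem.mpr hz
    rw [Real.volume_Ioo, ENNReal.ofReal_eq_zero] at this
    linarith
  have hl : ∀ᵐ r, r ∈ Ioo s t →
      Φ r ^ (m + 1) * (Φ r + r * w r) = Φ r₀ ^ (m + 1) * (Φ r₀ + r₀ * w r₀) := by
    filter_upwards [hdet] with r hr hrI
    exact h_inj ((hr hrI).trans hr₀.symm)
  set l := Φ r₀ ^ (m + 1) * (Φ r₀ + r₀ * w r₀)
  obtain ⟨c, hc⟩ := exists_const_on_Ioo_of_ae_hasDerivAt_zero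
    (f := fun r => r ^ (m + 2) * Φ r ^ (m + 2) - l * r ^ (m + 2)) (fun a ha b hb =>
      (((absolutelyContinuousOnInterval_id a b).fun_pow _).fun_mul
        ((hΦac a ha b hb).fun_pow _)).fun_sub
        (((absolutelyContinuousOnInterval_id a b).fun_pow _).const_mul l)) (by
    filter_upwards [hΦ.ae_hasDerivAt, hl] with r h1 h2 hr
    have h4 := (((hasDerivAt_id r).fun_pow (m + 2)).fun_mul
      ((h1 (hsub hr)).fun_pow (m + 2))).fun_sub (((hasDerivAt_id r).fun_pow (m + 2)).const_mul l)
    refine h4.congr_deriv ?_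
    -- The derivative of r^n Φ^n is n r^(n-1) times the determinant.
    rw [← h2 hr]
    simp
    ring)
  exact ⟨l, c, fun r hr => by have := hc r hr; linarith, hl⟩

/-- Near the zero z, |Φ|^n is at most a multiple of |r - z|. The constant determinant then makes |Φ
+ r w|^(n/(n-1)) at least a multiple of 1/|r - z|, which is not integrable up to z. -/
theorem false_of_zero_at_endpoint (hn : 2 ≤ n) (hΦc : ContinuousOn Φ (Ioo 0 1))
    (hint : ∀ a ∈ Ioo (0 : ℝ) 1, ∀ b ∈ Ioo (0 : ℝ) 1, IntervalIntegrable
      (fun r => |Φ r + r * w r| ^ ((n : ℝ) / (n - 1))) volume a b)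
    {z r₀ : ℝ} (hz : z ∈ Ioo (0 : ℝ) 1) (hr₀ : r₀ ∈ Ioo (0 : ℝ) 1) (hne : z ≠ r₀) (hΦz : Φ z = 0)
    (h0 : ∀ r ∈ Ioo (min z r₀) (max z r₀), Φ r ≠ 0) {l c : ℝ}
    (hpow : ∀ r ∈ Ioo (min z r₀) (max z r₀), r ^ n * Φ r ^ n = l * r ^ n + c)
    (hdet : ∀ᵐ r, r ∈ Ioo (min z r₀) (max z r₀) → Φ r ^ (n - 1) * (Φ r + r * w r) = l) :
    False := by
  have hn0 : n ≠ 0 := by omega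
  have hmM : min z r₀ < max z r₀ := min_lt_max.mpr hne
  have hm : 0 < min z r₀ := lt_min hz.1 hr₀.1
  have hM : max z r₀ < 1 := max_lt hz.2 hr₀.2
  have hI : Icc (min z r₀) (max z r₀) ⊆ Ioo 0 1 := Icc_subset_Ioo hm hM
  have heq : EqOn (fun r => r ^ n * Φ r ^ n) (fun r => l * r ^ n + c)
      (Icc (min z r₀) (max z r₀)) := by
    refine EqOn.of_subset_closure (s := Ioo (min z r₀) (max z r₀)) hpow ?_ (by fun_prop)
      Ioo_subset_Icc_self (closure_Ioo hmM.ne).ge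
    exact (continuousOn_pow n).mul ((hΦc.mono hI).pow n)
  have hc : c = -(l * z ^ n) := by
    have := heq (show z ∈ Icc (min z r₀) (max z r₀) from ⟨min_le_left _ _, le_max_left _ _⟩)
    simp only [hΦz, zero_pow hn0, mul_zero] at this
    linarith
  -- If l = 0 then c = 0 as well, and Φ would vanish between z and r₀.
  have hl : l ≠ 0 := by
    rintro rfl
    obtain ⟨r, hr⟩ := exists_between hmM
    have h1 := hpow r hr
    rw [hc] at h1
    have h2 : r ≠ 0 := (hm.trans hr.1).ne'
    simp [h2, h0 r hr, hn0] at h1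
  set q : ℝ := (n : ℝ) / (n - 1)
  have hn1 : (0 : ℝ) < n - 1 := by
    have : (2 : ℝ) ≤ n := by exact_mod_cast hn
    linarith
  have hbound : ∀ᵐ r, r ∈ Ioo (min z r₀) (max z r₀) → |(r - z)⁻¹| ≤
      |l| * n / (|l| ^ q * min z r₀ ^ n) * |Φ r + r * w r| ^ q := by
    filter_upwards [hdet] with r hr hrI
    have hrz : r ≠ z := by
      rintro rfl
      exact h0 r hrI hΦz
    have hrpos : 0 < |r - z| := abs_pos.mpr (sub_ne_zero.mpr hrz)
    -- The exponent q = n/(n-1) is the one with (n-1) q = n.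
    have e1 : |l| ^ q = |Φ r| ^ n * |Φ r + r * w r| ^ q := by
      rw [← hr hrI, abs_mul, Real.mul_rpow (abs_nonneg _) (abs_nonneg _), abs_pow,
        ← Real.rpow_natCast, ← Real.rpow_mul (abs_nonneg _), ← Real.rpow_natCast]
      congr 2
      rw [Nat.cast_sub (by omega), Nat.cast_one]
      simp only [q]
      field_simp
    have e2 : r ^ n * |Φ r| ^ n = |l| * |r ^ n - z ^ n| := by
      rw [← abs_mul, ← abs_pow, ← abs_of_pos (pow_pos (hm.trans hrI.1) n), ← abs_mul, hpow r hrI,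
        hc, abs_of_pos (pow_pos (hm.trans hrI.1) n)]
      congr 1
      ring
    have e3 : |r ^ n - z ^ n| ≤ |r - z| * n := by
      refine (abs_pow_sub_pow_le r z n).trans ?_
      refine mul_le_of_le_one_right (by positivity) (pow_le_one₀ (by positivity) ?_)
      rw [abs_of_pos (hm.trans hrI.1), abs_of_pos hz.1]
      exact max_le (hrI.2.le.trans hM.le) hz.2.le
    have e4 : min z r₀ ^ n * |Φ r| ^ n ≤ |l| * (|r - z| * n) :=
      calc _ ≤ r ^ n * |Φ r| ^ n := by gcongr; exact hrI.1.le
        _ = _ := e2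
        _ ≤ _ := by gcongr
    have hlq : 0 < |l| ^ q := Real.rpow_pos_of_pos (abs_pos.mpr hl) q
    have hB : 0 ≤ |Φ r + r * w r| ^ q := Real.rpow_nonneg (abs_nonneg _) q
    rw [abs_inv, inv_le_iff_one_le_mul₀ hrpos, div_mul_eq_mul_div, div_mul_eq_mul_div,
      one_le_div (mul_pos hlq (pow_pos hm n))]
    calc |l| ^ q * min z r₀ ^ n = (min z r₀ ^ n * |Φ r| ^ n) * |Φ r + r * w r| ^ q := by
          rw [e1]; ring
      _ ≤ (|l| * (|r - z| * n)) * |Φ r + r * w r| ^ q := by gcongr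
      _ = _ := by ring
  have hii : IntervalIntegrable (fun r => (r - z)⁻¹) volume z r₀ := by
    have h1 := (hint z hz r₀ hr₀).const_mul (|l| * n / (|l| ^ q * min z r₀ ^ n))
    rw [intervalIntegrable_iff] at h1 ⊢
    refine Integrable.mono' h1 (by fun_prop) ?_
    rw [ae_restrict_iff' measurableSet_uIoc]
    -- `uIoc` contains its larger endpoint while the bound holds on the open interval, so that point
    -- is discarded.
    filter_upwards [hbound, Measure.ae_ne volume (max z r₀)] with r hr hrM hrI
    exact hr ⟨hrI.1, lt_of_le_of_ne hrI.2 hrM⟩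
  rw [intervalIntegrable_sub_inv_iff] at hii
  rcases hii with h | h
  · exact hne h
  · exact h left_mem_uIcc

/-- The zeros between r₁ and r₀ form a compact set, on which the distance to r₀ attains its minimum.
-/
theorem exists_nearest_zero (hΦc : ContinuousOn Φ (Ioo 0 1)) {r₀ r₁ : ℝ}
    (hr₀ : r₀ ∈ Ioo (0 : ℝ) 1) (hr₁ : r₁ ∈ Ioo (0 : ℝ) 1) (h₁ : Φ r₁ = 0) :
    ∃ z ∈ Ioo (0 : ℝ) 1, Φ z = 0 ∧ ∀ r ∈ Ioo (min z r₀) (max z r₀), Φ r ≠ 0 := by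
  have hsub : uIcc r₁ r₀ ⊆ Ioo 0 1 := ordConnected_Ioo.uIcc_subset hr₁ hr₀
  have hK : IsCompact (uIcc r₁ r₀ ∩ Φ ⁻¹' {0}) := isCompact_uIcc.of_isClosed_subset
    ((hΦc.mono hsub).preimage_isClosed_of_isClosed isCompact_uIcc.isClosed isClosed_singleton)
    inter_subset_left
  obtain ⟨z, hz, hmin⟩ := hK.exists_isMinOn ⟨r₁, left_mem_uIcc, h₁⟩
    (f := fun x => |x - r₀|) (by fun_prop)
  refine ⟨z, hsub hz.1, hz.2, fun r hr h => ?_⟩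
  have hrI : r ∈ uIcc r₁ r₀ :=
    ordConnected_uIcc.uIcc_subset hz.1 right_mem_uIcc (Ioo_subset_Icc_self hr)
  have h2 : |z - r₀| ≤ |r - r₀| := hmin ⟨hrI, h⟩
  rcases le_total z r₀ with hzr | hzr
  · rw [min_eq_left hzr, max_eq_right hzr] at hr
    rw [abs_of_nonpos (by linarith), abs_of_nonpos (by linarith [hr.2])] at h2
    linarith [hr.1]
  · rw [min_eq_right hzr, max_eq_left hzr] at hr
    rw [abs_of_nonneg (by linarith), abs_of_nonneg (by linarith [hr.1])] at h2
    linarith [hr.2]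

theorem oddRoot_pow_self (hn : Odd n) (x : ℝ) : oddRoot n (x ^ n) = x :=
  hn.strictMono_pow.injective (oddRoot_pow hn (x ^ n))

theorem pos_or_neg_of_ne_zero (hΦc : ContinuousOn Φ (Ioo 0 1))
    (h0 : ∀ r ∈ Ioo (0 : ℝ) 1, Φ r ≠ 0) :
    (∀ r ∈ Ioo (0 : ℝ) 1, 0 < Φ r) ∨ ∀ r ∈ Ioo (0 : ℝ) 1, Φ r < 0 := by
  by_contra! hcon
  obtain ⟨⟨a, ha, ha0⟩, b, hb, hb0⟩ := hcon
  obtain ⟨r, hr, hr0⟩ := isPreconnected_Ioo.intermediate_value ha hb hΦc ⟨ha0, hb0⟩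
  exact h0 r hr hr0

/-- For odd n the power is injective. For even n the sign of Φ is constant by the intermediate value
theorem, which selects one branch for all radii. -/
theorem eq_root_of_pow_eq (hn : n ≠ 0) (hΦc : ContinuousOn Φ (Ioo 0 1))
    (h0 : ∀ r ∈ Ioo (0 : ℝ) 1, Φ r ≠ 0) {l c : ℝ}
    (hpow : ∀ r ∈ Ioo (0 : ℝ) 1, r ^ n * Φ r ^ n = l * r ^ n + c) :
    (Odd n ∧ ∀ r ∈ Ioo (0 : ℝ) 1, Φ r = oddRoot n (l + c / r ^ n)) ∨
      (Even n ∧ (∀ r ∈ Ioo (0 : ℝ) 1, 0 < l + c / r ^ n) ∧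
        ((∀ r ∈ Ioo (0 : ℝ) 1, Φ r = (l + c / r ^ n) ^ (1 / (n : ℝ))) ∨
          ∀ r ∈ Ioo (0 : ℝ) 1, Φ r = -(l + c / r ^ n) ^ (1 / (n : ℝ)))) := by
  have e : ∀ r ∈ Ioo (0 : ℝ) 1, l + c / r ^ n = Φ r ^ n := fun r hr => by
    have h1 := hpow r hr
    have h2 : r ^ n ≠ 0 := pow_ne_zero n hr.1.ne'
    field_simp
    linarith
  rcases n.even_or_odd with hev | hodd
  · refine Or.inr ⟨hev, fun r hr => ?_, ?_⟩
    · rw [e r hr]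
      exact hev.pow_pos (h0 r hr)
    · refine (pos_or_neg_of_ne_zero hΦc h0).imp (fun hp r hr => ?_) fun hneg r hr => ?_
      · rw [e r hr, one_div, Real.pow_rpow_inv_natCast (hp r hr).le hn]
      · rw [e r hr, one_div, ← hev.neg_pow, Real.pow_rpow_inv_natCast
          (neg_nonneg.mpr (hneg r hr).le) hn, neg_neg]
  · exact Or.inl ⟨hodd, fun r hr => by rw [e r hr, oddRoot_pow_self hodd]⟩

theorem IsPrimitiveOn.intervalIntegrable_rpow (hΦ : IsPrimitiveOn Φ w (Ioo 0 1)) {q : ℝ}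
    (hq : 0 < q) (hw : MemLpLoc w (ENNReal.ofReal q) (Ioo 0 1)) {a b : ℝ}
    (ha : a ∈ Ioo (0 : ℝ) 1) (hb : b ∈ Ioo (0 : ℝ) 1) :
    IntervalIntegrable (fun r => |Φ r + r * w r| ^ q) volume a b := by
  have hsub : uIcc a b ⊆ Ioo 0 1 := ordConnected_Ioo.uIcc_subset ha hb
  have hfin : IsFiniteMeasure (volume.restrict (uIcc a b)) :=
    ⟨by simpa using isCompact_uIcc.measure_lt_top⟩
  have hwL := hw (uIcc a b) isCompact_uIcc hsub
  have hc : ContinuousOn Φ (uIcc a b) := hΦ.continuousOn_Ioo.mono hsub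
  obtain ⟨M, hM⟩ := isCompact_uIcc.exists_bound_of_continuousOn hc
  have h1 : MemLp Φ (ENNReal.ofReal q) (volume.restrict (uIcc a b)) :=
    MemLp.of_bound (hc.aestronglyMeasurable measurableSet_uIcc) M
      (by filter_upwards [ae_restrict_mem measurableSet_uIcc] with r hr using hM r hr)
  have h2 : MemLp (fun r => r * w r) (ENNReal.ofReal q) (volume.restrict (uIcc a b)) := by
    refine hwL.mono (aestronglyMeasurable_id.mul hwL.1) ?_
    filter_upwards [ae_restrict_mem measurableSet_uIcc] with r hr
    have := hsub hr
    rw [norm_mul, Real.norm_of_nonneg this.1.le]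
    exact mul_le_of_le_one_left (norm_nonneg _) this.2.le
  have h3 := (h1.add h2).integrable_norm_rpow (by simpa using hq) (by simp)
  rw [ENNReal.toReal_ofReal hq.le] at h3
  exact IntegrableOn.intervalIntegrable h3

end Profile

/-! ### The classification -/

theorem mainTheorem5 (n : ℕ) (hn : 2 ≤ n) (h : ℝ → ℝ) (h_cont : Continuous h)
    (h_inj : Function.Injective h) (p q : ℝ≥0∞) (hp : (n : ℝ≥0∞) / ((n : ℝ≥0∞) - 1) ≤ p)
    (hpq : p.HolderConjugate q) (φ : ℝ → ℝ) (hφ : MemW1pLoc φ p (Ioo 0 1))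
    (Du : EuclideanSpace ℝ (Fin n) → Matrix (Fin n) (Fin n) ℝ)
    (hu : IsWeakSolution h (Metric.ball 0 1) (fun x => φ ‖x‖ • x) Du)
    (hq : MatrixMemLpLoc (stress h Du) q (Metric.ball 0 1)) :
    ∃ ψ : ℝ → ℝ, ContinuousOn ψ (Ioo 0 1) ∧ φ =ᵐ[volume.restrict (Ioo 0 1)] ψ ∧
      ((∀ r ∈ Ioo (0 : ℝ) 1, ψ r = 0) ∨
        ∃ l c : ℝ, (∀ r ∈ Ioo (0 : ℝ) 1, ψ r ≠ 0) ∧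
          ((Odd n ∧ ∀ r ∈ Ioo (0 : ℝ) 1, ψ r = oddRoot n (l + c / r ^ n)) ∨
            (Even n ∧ (∀ r ∈ Ioo (0 : ℝ) 1, 0 < l + c / r ^ n) ∧
              ((∀ r ∈ Ioo (0 : ℝ) 1, ψ r = (l + c / r ^ n) ^ (1 / (n : ℝ))) ∨
                ∀ r ∈ Ioo (0 : ℝ) 1, ψ r = -(l + c / r ^ n) ^ (1 / (n : ℝ)))))) := by
  have hn1 : (0 : ℝ) < n - 1 := by
    have : (2 : ℝ) ≤ n := by exact_mod_cast hn
    linarith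
  have hq0 : 0 < (n : ℝ) / (n - 1) := div_pos (by linarith) hn1
  have hqp : ENNReal.ofReal ((n : ℝ) / (n - 1)) ≤ p := by
    rwa [ENNReal.ofReal_div_of_pos hn1, ENNReal.ofReal_sub _ zero_le_one, ENNReal.ofReal_natCast,
      ENNReal.ofReal_one]
  have hp1 : 1 ≤ p := by
    refine le_trans ?_ hqp
    rw [ENNReal.one_le_ofReal, one_le_div hn1]
    linarith
  obtain ⟨hφL, w, hwL, hweak⟩ := hφ
  obtain ⟨Φ, hΦ, hφΦ⟩ := exists_isPrimitiveOn_of_weakDeriv one_pos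
    (hφL.locallyIntegrableOn isOpen_Ioo hp1) (hwL.locallyIntegrableOn isOpen_Ioo hp1)
    fun η h1 h2 h3 => by
      have := hweak η h1 h2 h3
      rw [setIntegral_mul_eq_integral_of_tsupport_subset h3] at this
      simp only [fderiv_apply_one_eq_deriv] at this
      rwa [setIntegral_mul_eq_integral_of_tsupport_subset (tsupport_deriv_subset.trans h3)] at this
  have hΦc := hΦ.continuousOn_Ioo
  refine ⟨Φ, hΦc, (ae_restrict_iff' measurableSet_Ioo).mpr hφΦ, ?_⟩
  by_cases hzero : ∀ r ∈ Ioo (0 : ℝ) 1, Φ r = 0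
  · exact Or.inl hzero
  push Not at hzero
  obtain ⟨r₀, hr₀, hΦr₀⟩ := hzero
  obtain ⟨F, hF, hFe⟩ := hu.exists_isPrimitiveOn hn hφΦ hΦ
  have hwq : MemLpLoc w (ENNReal.ofReal ((n : ℝ) / (n - 1))) (Ioo 0 1) := fun K hK hKs => by
    have : IsFiniteMeasure (volume.restrict K) := ⟨by simpa using hK.measure_lt_top⟩
    exact (hwL K hK hKs).mono_exponent hqp
  -- One nonzero value excludes every zero, so the formula then holds on all of (0, 1) with a single
  -- pair of constants.
  have h0 : ∀ r ∈ Ioo (0 : ℝ) 1, Φ r ≠ 0 := by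
    intro r₁ hr₁ h₁
    obtain ⟨z, hz, hΦz, hne⟩ := exists_nearest_zero hΦc hr₀ hr₁ h₁
    have hzr : z ≠ r₀ := by
      rintro rfl
      exact hΦr₀ hΦz
    obtain ⟨l, c, hpow, hdet⟩ := exists_pow_eq_of_ne_zero hn h_inj hΦ hF hFe
      (le_min hz.1.le hr₀.1.le) (min_lt_max.mpr hzr) (max_le hz.2.le hr₀.2.le) hne
    exact false_of_zero_at_endpoint hn hΦc
      (fun a ha b hb => hΦ.intervalIntegrable_rpow hq0 hwq ha hb) hz hr₀ hzr hΦz hne hpow hdet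
  obtain ⟨l, c, hpow, -⟩ := exists_pow_eq_of_ne_zero hn h_inj hΦ hF hFe le_rfl one_pos le_rfl h0
  exact Or.inr ⟨l, c, h0, eq_root_of_pow_eq (by omega) hΦc h0 hpow⟩
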